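/- Let $T:K\to K$ be a homeomorphism of a compact Hausdorff space, let $C(K)$ be the C*-algebra of continuous complex-valued functions on $K$, and let $\alpha_T(f)=f\circ T$ for $f\in C(K)$. A set $I\subseteq\mathbb{Z}$ is an *$\ell_1$-isomorphism set* for $f\in C(K)$ if there is a bijection from the standard basis of $\ell_1^I$ onto $\Delta=\{\alpha_T^i(f): i\in I\}$ that extends to a Banach space isomorphism (bounded linear, with bounded inverse) of $\ell_1^I$ onto $\overline{\operatorname{span}}\,\Delta$. The set $I$ has *positive density* if the limit $\lim_{n\to\infty}\frac{|I\cap\{-n,\dots,n\}|}{2n+1}$ exists and is positive. A *factor* of $(K,T)$ is a homeomorphism $S:L\to L$ of a compact Hausdorff space together with a continuous surjection $\pi:K\to L$ such that $\pi\circ T=S\circ\pi$; it is *nontrivial* if $L$ has more than one point; its algebra is $\{g\circ\pi : g\in C(L)\}\subseteq C(K)$. Then the following hold. 1. Among the factors of $(K,T)$ with zero topological entropy there is a largest one (the topological Pinsker factor), that is, one through which the factor map of every zero entropy factor of $(K,T)$ factors equivariantly. Its algebra, the topological Pinsker algebra $P_{K,T}$, is equal to the set of all $f\in C(K)$ which do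 not have an $\ell_1$-isomorphism set of positive density. 2. $T$ has positive topological entropy if and only if there is an $f\in C(K)$ with an $\ell_1$-isomorphism set of positive density. 3. $T$ has completely positive entropy (every nontrivial factor of $(K,T)$ has positive topological entropy) if and only if every nonconstant $f\in C(K)$ has an $\ell_1$-isomorphism set of positive density. -/

import Mathlib

open Set Filter Topology

universe u

namespace PinskerL1

noncomputable section

/-- `Δ` is equivalent to the standard basis of `ℓ₁^I`: some bijection from the standard basis
(indexed by `I`) onto `Δ` extends to an isomorphism of `ℓ₁^I` onto the closed span of `Δ`. -/
def EquivalentToL1Basis {X : Type*} [NormedAddCommGroup X] [NormedSpace ℂ X]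
    {ι : Type*} [DecidableEq ι] (Δ : Set X) : Prop :=
  ∃ (e : ι ≃ Δ)
    (γ : lp (fun _ : ι => ℂ) 1 ≃L[ℂ] (Submodule.span ℂ Δ).topologicalClosure),
    ∀ i : ι, (γ (lp.single 1 i (1 : ℂ)) : X) = (e i : X)

/-- `I ⊆ ℤ` is an `ℓ₁`-isomorphism set for `x` under the isometric automorphism `α`. -/
def IsL1IsomorphismSet {X : Type*} [NormedAddCommGroup X] [NormedSpace ℂ X]
    (α : X ≃ₗᵢ[ℂ] X) (x : X) (I : Set ℤ) : Prop :=
  EquivalentToL1Basis (ι := I) ((fun i : ℤ => (α ^ i) x) '' I)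

/-- `I ⊆ ℤ` has density `d`: the ratios `|I ∩ {-n, …, n}| / (2n+1)` converge to `d`. -/
def HasDensity (I : Set ℤ) (d : ℝ) : Prop :=
  Tendsto (fun n : ℕ => ((I ∩ Set.Icc (-(n : ℤ)) (n : ℤ)).ncard : ℝ) / (2 * (n : ℝ) + 1))
    atTop (𝓝 d)

/-- The isometric automorphism `f ↦ f ∘ T` of `C(K)` induced by a homeomorphism `T`. -/
def inducedAut {K : Type*} [TopologicalSpace K] [CompactSpace K] (T : K ≃ₜ K) :
    C(K, ℂ) ≃ₗᵢ[ℂ] C(K, ℂ) where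
  toFun f := f.comp (T : C(K, K))
  invFun f := f.comp (T.symm : C(K, K))
  left_inv f := by ext x; simp
  right_inv f := by ext x; simp
  map_add' f g := rfl
  map_smul' c f := rfl
  norm_map' f := by
    apply le_antisymm
    · exact (ContinuousMap.norm_le _ (norm_nonneg f)).2 fun x => f.norm_coe_le_norm (T x)
    · refine (ContinuousMap.norm_le _ (norm_nonneg _)).2 fun x => ?_
      have h := (f.comp (T : C(K, K))).norm_coe_le_norm (T.symm x)
      simpa using h

/-- `f ∈ C(K)` has an `ℓ₁`-isomorphism set of positive density (with respect to `f ↦ f ∘ T`). -/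
def HasPosDensityL1Set {K : Type*} [TopologicalSpace K] [CompactSpace K] (T : K ≃ₜ K)
    (f : C(K, ℂ)) : Prop :=
  ∃ I : Set ℤ, (∃ d : ℝ, 0 < d ∧ HasDensity I d) ∧ IsL1IsomorphismSet (inducedAut T) f I

/-- Topological entropy of a homeomorphism of a compact Hausdorff space, computed with the unique
compatible uniformity. It is nonnegative unless the space is empty, where it is `⊥`. -/
def topEntropy {K : Type*} [TopologicalSpace K] [CompactSpace K] [T2Space K] (T : K ≃ₜ K) :
    EReal :=
  letI : UniformSpace K := uniformSpaceOfCompactR1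
  Dynamics.coverEntropy T Set.univ

/-- A factor of `(K, T)`: a homeomorphism of a compact Hausdorff space together with an
equivariant continuous surjection from `K`. Every such space is homeomorphic to a quotient of `K`,
so nothing is lost by keeping it in the universe of `K`. -/
structure Factor {K : Type u} [TopologicalSpace K] (T : K ≃ₜ K) : Type (u + 1) where
  space : Type u
  [topologicalSpace : TopologicalSpace space]
  [compactSpace : CompactSpace space]
  [t2Space : T2Space space]
  homeo : space ≃ₜ space
  proj : C(K, space)
  surjective : Function.Surjective proj
  equivariant : ∀ x, proj (T x) = homeo (proj x)

attribute [instance] Factor.topologicalSpace Factor.compactSpace Factor.t2Space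

namespace Factor

variable {K : Type u} [TopologicalSpace K] {T : K ≃ₜ K}

/-- The topological entropy of a factor. -/
def entropy (F : Factor T) : EReal := topEntropy F.homeo

/-- Zero topological entropy; `≤` instead of `=` matters only for the empty space. -/
def HasZeroEntropy (F : Factor T) : Prop := F.entropy ≤ 0

/-- `F` is smaller than `G`: the factor map onto `F` factors through the factor map onto `G` by a
morphism of systems. -/
def IsBelow (F G : Factor T) : Prop :=
  ∃ ρ : C(G.space, F.space),
    (∀ y, ρ (G.homeo y) = F.homeo (ρ y)) ∧ ∀ x, ρ (G.proj x) = F.proj x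

/-- `F` is the topological Pinsker factor, i.e. the largest factor with zero entropy. -/
def IsPinsker (F : Factor T) : Prop :=
  F.HasZeroEntropy ∧ ∀ G : Factor T, G.HasZeroEntropy → G.IsBelow F

/-- The C*-subalgebra `{g ∘ π : g ∈ C(L)}` of `C(K)` corresponding to a factor `π : K → L`. -/
def algebra (F : Factor T) : StarSubalgebra ℂ C(K, ℂ) :=
  (ContinuousMap.compStarAlgHom' ℂ ℂ F.proj).range

end Factor

/-- Completely positive entropy: every nontrivial factor has positive topological entropy. -/
def HasCompletelyPositiveEntropy {K : Type u} [TopologicalSpace K] (T : K ≃ₜ K) : Prop :=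
  ∀ F : Factor T, Nontrivial F.space → 0 < F.entropy

end

end PinskerL1

/-! The core is a dichotomy for a single function (`hasPosDensityL1Set_iff`): `f` has an
`ℓ₁`-isomorphism set of positive density exactly when the orbits observed through `f` have
exponential complexity at some scale.

If such a set exists, the lower `ℓ₁`-estimate makes every signed sum of the functions `f ∘ T^i`
large in norm. By Hoeffding's inequality a single orbit can make only an exponentially small
fraction of the signed sums large, so exponentially many distinguishable orbits are needed
(`not_hasSubexpComplexity`). Conversely, exponential complexity yields exponentially many separated
words over a finite alphabet. A Sauer–Shelah type argument (`exists_shattered`) finds a positive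
proportion of times at which two distant values can be prescribed independently, and independence
gives an `ℓ₁`-estimate with a constant not depending on the length (`lower_bound_of_independent`).
These estimates are hereditary and translation invariant, so Fekete's lemma and an ultrafilter limit
produce one infinite set having a density (`exists_hasDensity`).

On the side of entropy, a system has zero entropy exactly when all its continuous functions have
subexponential complexity. By compactness the class of such functions contains every continuous
function that separates no more points than the class does. Hence joint evaluation of the class is a
factor map whose algebra is precisely the class; this factor is the Pinsker factor, and all three
claims follow from the dichotomy. -/

namespace PinskerL1

/-! ### Subexponential complexity and topological entropy. -/

/-- The minimal size of a set which `U`-shadows all orbits of `T` up to time `n` grows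
subexponentially. -/
def SubexpCover {K : Type*} (T : K → K) (U : SetRel K K) : Prop :=
  ∀ c : ℝ, 0 < c → ∀ᶠ n : ℕ in atTop, ∃ E : Finset K, (E.card : ℝ) ≤ Real.exp (c * n) ∧
    ∀ x, ∃ y ∈ E, ∀ k < n, (T^[k] x, T^[k] y) ∈ U

/-- The pairs of points at which the values of `f` are `ε`-close. -/
def valueRel {K : Type*} (f : K → ℂ) (ε : ℝ) : SetRel K K :=
  {p | dist (f p.1) (f p.2) < ε}

/-- The orbits of `T`, observed through `f` at any fixed scale, have subexponential complexity. -/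
def HasSubexpComplexity {K : Type*} (T : K → K) (f : K → ℂ) : Prop :=
  ∀ ε : ℝ, 0 < ε → SubexpCover T (valueRel f ε)

theorem SubexpCover.mono {K : Type*} {T : K → K} {U V : SetRel K K} (h : SubexpCover T U)
    (hUV : U ⊆ V) : SubexpCover T V := by
  intro c hc
  filter_upwards [h c hc] with n hn
  obtain ⟨E, hE, hx⟩ := hn
  refine ⟨E, hE, fun x => ?_⟩
  obtain ⟨y, hy, hk⟩ := hx x
  exact ⟨y, hy, fun k hkn => hUV (hk k hkn)⟩

theorem subexpCover_iff {K : Type*} (T : K → K) (U : SetRel K K) :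
    SubexpCover T U ↔ Dynamics.coverEntropyEntourage T univ U ≤ 0 := by
  have key : ∀ (c : ℝ) (n : ℕ),
      (∃ E : Finset K, (E.card : ℝ) ≤ Real.exp (c * n) ∧
        ∀ x, ∃ y ∈ E, ∀ k < n, (T^[k] x, T^[k] y) ∈ U) ↔
      ((Dynamics.coverMincard T univ U n : ℕ∞) : ENNReal) ≤ EReal.exp ((c : EReal) * n) := by
    intro c n
    have hexp : EReal.exp ((c : EReal) * n) = ENNReal.ofReal (Real.exp (c * n)) := by
      rw [← EReal.exp_coe]; norm_cast
    have hcov : ∀ E : Finset K, Dynamics.IsDynCoverOf T univ U n E ↔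
        ∀ x, ∃ y ∈ E, ∀ k < n, (T^[k] x, T^[k] y) ∈ U := by
      intro E
      simp only [Dynamics.IsDynCoverOf, SetRel.IsCover, Dynamics.mem_dynEntourage]
      simp
    rw [hexp]
    constructor
    · rintro ⟨E, hE, hx⟩
      have h1 := ((hcov E).2 hx).coverMincard_le_card
      have h2 : ((Dynamics.coverMincard T univ U n : ℕ∞) : ENNReal) ≤ (E.card : ENNReal) := by
        simpa using ENat.toENNReal_mono h1
      refine h2.trans ?_
      rw [← ENNReal.ofReal_natCast]
      exact ENNReal.ofReal_le_ofReal hE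
    · intro h
      have hlt : Dynamics.coverMincard T univ U n < ⊤ := by
        rw [lt_top_iff_ne_top]
        intro htop
        rw [htop] at h
        simp at h
      obtain ⟨E, hE, hcard⟩ := (Dynamics.coverMincard_finite_iff T univ U n).1 hlt
      refine ⟨E, ?_, (hcov E).1 hE⟩
      rw [← hcard, ENat.toENNReal_coe, ← ENNReal.ofReal_natCast] at h
      exact (ENNReal.ofReal_le_ofReal_iff (Real.exp_pos _).le).1 h
  rw [Dynamics.coverEntropyEntourage, ExpGrowth.expGrowthSup_le_iff]
  constructor
  · intro h b hb
    obtain ⟨c, hc0, hcb⟩ := EReal.exists_between_coe_real hb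
    filter_upwards [h c (by exact_mod_cast hc0)] with n hn
    refine ((key c n).1 hn).trans ?_
    gcongr
  · intro h c hc
    filter_upwards [h c (by exact_mod_cast hc)] with n hn
    exact (key c n).2 hn

theorem subexpCover_finset {K : Type*} {T : K → K} (S : Finset (K → ℂ))
    (hS : ∀ g ∈ S, HasSubexpComplexity T g) {δ : ℝ} (hδ : 0 < δ) :
    SubexpCover T {p | ∀ g ∈ S, dist (g p.1) (g p.2) < δ} := by
  classical
  induction S using Finset.induction_on generalizing δ with
  | empty =>
    intro c hc
    refine Eventually.of_forall fun n => ?_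
    rcases isEmpty_or_nonempty K with hK | ⟨⟨x⟩⟩
    · exact ⟨∅, by simpa using (Real.exp_pos _).le, fun x => hK.elim x⟩
    · exact ⟨{x}, by simpa using by positivity, fun y => ⟨x, by simp⟩⟩
  | insert g S _ ih =>
    intro c hc
    have h1 := hS g (Finset.mem_insert_self _ _) (δ / 2) (by positivity) (c / 2) (by positivity)
    have h2 := ih (fun g' hg' => hS g' (Finset.mem_insert_of_mem hg')) (δ := δ / 2) (by positivity)
      (c / 2) (by positivity)
    filter_upwards [h1, h2] with n hn1 hn2
    obtain ⟨E, hE, hxE⟩ := hn1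
    obtain ⟨F, hF, hxF⟩ := hn2
    let R : K × K → K → Prop := fun q x =>
      (∀ k < n, (T^[k] x, T^[k] q.1) ∈ valueRel g (δ / 2)) ∧
      ∀ k < n, (T^[k] x, T^[k] q.2) ∈
        ({p | ∀ g ∈ S, dist (g p.1) (g p.2) < δ / 2} : SetRel K K)
    -- A pair of centres is replaced by one point shadowed by both; the triangle inequality then
    -- doubles the scale, which is why `δ / 2` is used. The two exponents `c / 2` add up in the
    -- product.
    let z : K × K → K := fun q => if h : ∃ x, R q x then h.choose else q.1
    have hz : ∀ q x, R q x → R q (z q) := by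
      intro q x hx
      have h : ∃ x, R q x := ⟨x, hx⟩
      simp only [z, dif_pos h]
      exact h.choose_spec
    refine ⟨(E ×ˢ F).image z, ?_, fun x => ?_⟩
    · calc (((E ×ˢ F).image z).card : ℝ) ≤ ((E ×ˢ F).card : ℝ) := by
            exact_mod_cast Finset.card_image_le
        _ = (E.card : ℝ) * F.card := by rw [Finset.card_product]; push_cast; rfl
        _ ≤ Real.exp (c / 2 * n) * Real.exp (c / 2 * n) := by gcongr
        _ = Real.exp (c * n) := by rw [← Real.exp_add]; ring_nf
    · obtain ⟨y, hy, hyx⟩ := hxE x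
      obtain ⟨y', hy', hyx'⟩ := hxF x
      have hR := hz (y, y') x ⟨hyx, hyx'⟩
      refine ⟨z (y, y'), Finset.mem_image_of_mem _ (Finset.mk_mem_product hy hy'), ?_⟩
      intro k hk g' hg'
      rcases Finset.mem_insert.1 hg' with rfl | hg'
      · have a := hyx k hk
        have b := hR.1 k hk
        simp only [valueRel, mem_ofPred_eq] at a b ⊢
        have := dist_triangle_right (g' (T^[k] x)) (g' (T^[k] (z (y, y')))) (g' (T^[k] y))
        linarith
      · have a := hyx' k hk g' hg'
        have b := hR.2 k hk g' hg'
        simp only at a b ⊢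
        have := dist_triangle_right (g' (T^[k] x)) (g' (T^[k] (z (y, y')))) (g' (T^[k] y'))
        linarith

theorem exists_finset_separating {K : Type*} [TopologicalSpace K] (𝒢 : Set C(K, ℂ))
    {C : Set (K × K)} (hC : IsCompact C) (hsep : ∀ p ∈ C, ∃ g ∈ 𝒢, g p.1 ≠ g p.2) :
    ∃ S : Finset C(K, ℂ), (∀ g ∈ S, g ∈ 𝒢) ∧ ∃ δ : ℝ, 0 < δ ∧
      ∀ p ∈ C, ∃ g ∈ S, δ ≤ dist (g p.1) (g p.2) := by
  classical
  refine hC.induction_on (p := fun C => ∃ S : Finset C(K, ℂ), (∀ g ∈ S, g ∈ 𝒢) ∧ ∃ δ : ℝ, 0 < δ ∧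
      ∀ p ∈ C, ∃ g ∈ S, δ ≤ dist (g p.1) (g p.2)) ?_ ?_ ?_ ?_
  · exact ⟨∅, by simp, 1, one_pos, by simp⟩
  · rintro s t hst ⟨S, hS, δ, hδ, h⟩
    exact ⟨S, hS, δ, hδ, fun p hp => h p (hst hp)⟩
  · rintro s t ⟨S, hS, δ, hδ, h⟩ ⟨S', hS', δ', hδ', h'⟩
    refine ⟨S ∪ S', fun g hg => ?_, min δ δ', lt_min hδ hδ', ?_⟩
    · rcases Finset.mem_union.1 hg with hg | hg
      exacts [hS g hg, hS' g hg]
    · rintro p (hp | hp)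
      · obtain ⟨g, hg, hle⟩ := h p hp
        exact ⟨g, Finset.mem_union_left _ hg, (min_le_left _ _).trans hle⟩
      · obtain ⟨g, hg, hle⟩ := h' p hp
        exact ⟨g, Finset.mem_union_right _ hg, (min_le_right _ _).trans hle⟩
  · intro p hp
    obtain ⟨g, hg, hne⟩ := hsep p hp
    have hpos : 0 < dist (g p.1) (g p.2) := dist_pos.2 hne
    refine ⟨{q | dist (g p.1) (g p.2) / 2 < dist (g q.1) (g q.2)}, ?_, {g}, by simpa using hg,
      _, half_pos hpos, fun q hq => ⟨g, by simp, le_of_lt hq⟩⟩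
    refine mem_nhdsWithin_of_mem_nhds (IsOpen.mem_nhds ?_ (half_lt_self hpos))
    exact isOpen_lt continuous_const (by fun_prop)

section

variable {K : Type*} [TopologicalSpace K] [CompactSpace K]

/-- The complement of `U` is compact, so finitely many members of `𝒢` separate all its pairs with a
uniform gap `δ`, and a common cover for these at scale `δ` is a `U`-cover. No approximation in norm
by an algebra is needed. -/
theorem subexpCover_of_isOpen {T : K → K} (𝒢 : Set C(K, ℂ))
    (h𝒢 : ∀ g ∈ 𝒢, HasSubexpComplexity T g) {U : Set (K × K)} (hU : IsOpen U)
    (hsep : ∀ x y, (∀ g ∈ 𝒢, g x = g y) → (x, y) ∈ U) : SubexpCover T U := by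
  classical
  obtain ⟨S, hS, δ, hδ, h⟩ := exists_finset_separating 𝒢 hU.isClosed_compl.isCompact (by
    rintro ⟨x, y⟩ hp
    by_contra! hcon
    exact hp (hsep x y hcon))
  refine (subexpCover_finset (T := T) (S.image (fun g : C(K, ℂ) => (g : K → ℂ))) ?_ hδ).mono ?_
  · intro g hg
    obtain ⟨g', hg', rfl⟩ := Finset.mem_image.1 hg
    exact h𝒢 g' (hS g' hg')
  · intro p hp
    by_contra hpU
    obtain ⟨g, hg, hle⟩ := h p hpU
    exact absurd (hp g (Finset.mem_image_of_mem _ hg)) (not_lt.2 hle)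

/-- A continuous function which does not separate more points than the functions of subexponential
complexity is of subexponential complexity. -/
theorem hasSubexpComplexity_of_separation {T : K → K} (f : C(K, ℂ))
    (hf : ∀ x y, (∀ g : C(K, ℂ), HasSubexpComplexity T g → g x = g y) → f x = f y) :
    HasSubexpComplexity T f := by
  intro ε hε
  refine subexpCover_of_isOpen {g : C(K, ℂ) | HasSubexpComplexity T g} (fun g hg => hg) ?_ ?_
  · exact isOpen_lt (by fun_prop) continuous_const
  · intro x y hxy
    simpa [valueRel, hf x y hxy] using hε

theorem eq_of_forall_apply_eq [T2Space K] {x y : K} (h : ∀ g : C(K, ℂ), g x = g y) : x = y := by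
  by_contra hne
  obtain ⟨g, hg0, hg1, -⟩ := exists_continuous_zero_one_of_isClosed (isClosed_singleton (x := x))
    (isClosed_singleton (x := y)) (by simpa using hne)
  have := h ⟨fun t => (g t : ℂ), by fun_prop⟩
  simp [hg0 (mem_singleton x), hg1 (mem_singleton y)] at this

/-- Uniform continuity bounds the complexity of a function by that of an entourage; the converse
uses that continuous functions separate points. Stating it with `≤` covers the empty space. -/
theorem topEntropy_le_zero_iff [T2Space K] (T : K ≃ₜ K) :
    topEntropy T ≤ 0 ↔ ∀ f : C(K, ℂ), HasSubexpComplexity T f := by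
  let _ : UniformSpace K := uniformSpaceOfCompactR1
  change Dynamics.coverEntropy T univ ≤ 0 ↔ _
  constructor
  · intro h f ε hε
    rw [subexpCover_iff]
    refine (Dynamics.coverEntropyEntourage_le_coverEntropy T univ ?_).trans h
    exact (CompactSpace.uniformContinuous_of_continuous f.continuous) (Metric.dist_mem_uniformity hε)
  · intro h
    refine iSup₂_le fun U hU => ?_
    rw [← subexpCover_iff]
    refine (subexpCover_of_isOpen (T := T) univ (fun g _ => h g) (isOpen_interior (s := U))
      fun x y hxy => ?_).mono interior_subset
    have hxy : x = y := eq_of_forall_apply_eq fun g => hxy g (mem_univ g)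
    subst hxy
    exact refl_mem_uniformity (interior_mem_uniformity hU)

end

/-! ### Combinatorics of words: independence at a positive proportion of the indices. -/

section Words

-- A Chernoff bound: weight each partial function by `x` to the size of its support. The total
-- weight factors over the indices, and each sparse function has weight at least `x ^ d`.
open Classical in
theorem card_sparse_mul_pow_le {ι β : Type*} [Fintype ι] [Fintype β] {x : ℝ} (hx0 : 0 < x)
    (hx1 : x ≤ 1) (d : ℕ) :
    ((Finset.univ.filter fun p : ι → Option β =>
        (Finset.univ.filter fun i => (p i).isSome).card ≤ d).card : ℝ) * x ^ d ≤
      (1 + Fintype.card β * x) ^ Fintype.card ι := by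
  calc _ = ∑ p ∈ Finset.univ.filter (fun p : ι → Option β =>
        (Finset.univ.filter fun i => (p i).isSome).card ≤ d), x ^ d := by
        rw [Finset.sum_const, nsmul_eq_mul]
    _ ≤ ∑ p ∈ Finset.univ.filter (fun p : ι → Option β =>
        (Finset.univ.filter fun i => (p i).isSome).card ≤ d),
          ∏ i, (if (p i).isSome then x else 1) := by
        refine Finset.sum_le_sum fun p hp => ?_
        rw [Finset.prod_ite]
        simp only [Finset.prod_const, one_pow, mul_one]
        exact pow_le_pow_of_le_one hx0.le hx1 (Finset.mem_filter.1 hp).2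
    _ ≤ ∑ p : ι → Option β, ∏ i, (if (p i).isSome then x else 1) := by
        refine Finset.sum_le_sum_of_subset_of_nonneg (Finset.filter_subset _ _) fun p _ _ => ?_
        exact Finset.prod_nonneg fun i _ => by split_ifs <;> positivity
    _ = ∏ i : ι, ∑ o : Option β, (if o.isSome then x else 1) := by
        rw [Finset.prod_univ_sum]; simp
    _ = (1 + Fintype.card β * x) ^ Fintype.card ι := by
        simp [Fintype.sum_option]

open Classical in
/-- There are few partial functions with small support. -/
theorem exists_card_sparse_le (β : Type*) [Fintype β] {c : ℝ} (hc : 0 < c) :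
    ∃ η : ℝ, 0 < η ∧ η ≤ 1 ∧ ∀ (ι : Type) [Fintype ι],
      ((Finset.univ.filter fun p : ι → Option β =>
        ((Finset.univ.filter fun i => (p i).isSome).card : ℝ) ≤ η * Fintype.card ι).card : ℝ) ≤
      Real.exp (c * Fintype.card ι) := by
  obtain ⟨L, hL1, hL⟩ : ∃ L : ℝ, 1 ≤ L ∧ (Fintype.card β : ℝ) * Real.exp (-L) ≤ c / 2 := by
    have h : Tendsto (fun L : ℝ => (Fintype.card β : ℝ) * Real.exp (-L)) atTop (𝓝 0) := by
      simpa using (Real.tendsto_exp_neg_atTop_nhds_zero).const_mul (Fintype.card β : ℝ)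
    exact ((eventually_ge_atTop 1).and (h.eventually_le_const (half_pos hc))).exists
  have hL0 : 0 < L := by linarith
  -- With `x = exp (-L)` the generating function is at most `exp (c / 2 * n)`; this `η` makes the
  -- loss `x ^ (-d)` at most `exp (c / 2 * n)` as well.
  refine ⟨min 1 (c / (2 * L)), by positivity, min_le_left _ _, fun ι _ => ?_⟩
  set n := Fintype.card ι with hn
  set d := ⌊min 1 (c / (2 * L)) * n⌋₊ with hd
  have hdn : (d : ℝ) ≤ c / (2 * L) * n :=
    (Nat.floor_le (by positivity)).trans (by gcongr; exact min_le_right _ _)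
  have h := card_sparse_mul_pow_le (ι := ι) (β := β) (Real.exp_pos (-L))
    (Real.exp_le_one_iff.2 (by linarith)) d
  have heq : ∀ p : ι → Option β,
      (((Finset.univ.filter fun i => (p i).isSome).card : ℝ) ≤ min 1 (c / (2 * L)) * n) ↔
      (Finset.univ.filter fun i => (p i).isSome).card ≤ d := fun p =>
    (Nat.le_floor_iff (by positivity)).symm
  simp only [heq]
  have h2 : (1 + Fintype.card β * Real.exp (-L)) ^ n ≤ Real.exp (c / 2 * n) := by
    calc (1 + Fintype.card β * Real.exp (-L)) ^ n ≤ (Real.exp (c / 2)) ^ n := by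
          gcongr
          linarith [Real.add_one_le_exp (c / 2)]
      _ = _ := by rw [← Real.exp_nat_mul]; ring_nf
  have h3 : Real.exp (-L) ^ d = Real.exp (-(L * d)) := by
    rw [← Real.exp_nat_mul]; ring_nf
  have h4 : L * d ≤ c / 2 * n := by
    calc L * d ≤ L * (c / (2 * L) * n) := by gcongr
      _ = c / 2 * n := by field_simp
  rw [h3] at h
  have h5 := h.trans h2
  rw [Real.exp_neg, ← div_eq_mul_inv, div_le_iff₀ (Real.exp_pos _), ← Real.exp_add] at h5
  exact h5.trans (Real.exp_le_exp.2 (by linarith))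

variable {ι α : Type*}

/-- `p` assigns to each index of a set an ordered pair of symbols in the relation `far`, and every
choice of one of the two symbols at each of these indices is realised by a word in `F`. -/
def Shatters (far : α → α → Prop) (F : Finset (ι → α)) (p : ι → Option (α × α)) : Prop :=
  (∀ i q, p i = some q → far q.1 q.2) ∧
  ∀ σ : ι → Prop, ∃ w ∈ F, ∀ i q, p i = some q → (σ i → w i = q.1) ∧ (¬ σ i → w i = q.2)

theorem Shatters.mono {far : α → α → Prop} {F G : Finset (ι → α)} (hFG : F ⊆ G)
    {p : ι → Option (α × α)} (h : Shatters far F p) : Shatters far G p :=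
  ⟨h.1, fun σ => let ⟨w, hw, hp⟩ := h.2 σ; ⟨w, hFG hw, hp⟩⟩

-- The inductive step of a Sauer–Shelah argument. A pattern shattered by one of the two subfamilies
-- is undefined at `i`, where all its words agree. A pattern shattered by both gives a further one
-- by assigning `(a, b)` at `i`, so patterns counted twice on the left are matched by new ones on
-- the right.
open Classical in
theorem card_shattered_add_le [Fintype ι] [Fintype α] {far : α → α → Prop}
    (hirr : ∀ a, ¬ far a a) (F : Finset (ι → α)) {i : ι} {a b : α} (hab : far a b) :
    (Finset.univ.filter (Shatters far (F.filter fun w => w i = a))).card +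
      (Finset.univ.filter (Shatters far (F.filter fun w => w i = b))).card ≤
    (Finset.univ.filter (Shatters far F)).card := by
  set A := Finset.univ.filter (Shatters far (F.filter fun w => w i = a)) with hA
  set B := Finset.univ.filter (Shatters far (F.filter fun w => w i = b)) with hB
  have hne : a ≠ b := fun h => hirr b (h ▸ hab)
  have hnone : ∀ (e : α) p, Shatters far (F.filter fun w => w i = e) p → p i = none := by
    intro e p hp
    by_contra hcon
    obtain ⟨q, hq⟩ := Option.ne_none_iff_exists'.1 hcon
    obtain ⟨w, hw, h1⟩ := hp.2 (fun _ => True)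
    obtain ⟨w', hw', h2⟩ := hp.2 (fun _ => False)
    have e1 := (h1 i q hq).1 trivial
    have e2 := (h2 i q hq).2 id
    rw [(Finset.mem_filter.1 hw).2] at e1
    rw [(Finset.mem_filter.1 hw').2] at e2
    have := hp.1 i q hq
    rw [← e1, ← e2] at this
    exact hirr _ this
  let u : (ι → Option (α × α)) → (ι → Option (α × α)) := fun p => Function.update p i (some (a, b))
  have hinj : Set.InjOn u ((A ∩ B : Finset _) : Set (ι → Option (α × α))) := by
    intro p hp p' hp' hpp
    have h1 := hnone a p (Finset.mem_filter.1 (Finset.mem_inter.1 hp).1).2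
    have h2 := hnone a p' (Finset.mem_filter.1 (Finset.mem_inter.1 hp').1).2
    funext j
    by_cases hj : j = i
    · subst hj; rw [h1, h2]
    · have := congrFun hpp j
      simpa [u, Function.update_of_ne hj] using this
  have hdisj : Disjoint (A ∪ B) ((A ∩ B).image u) := by
    rw [Finset.disjoint_left]
    intro p hp hp'
    obtain ⟨p', -, rfl⟩ := Finset.mem_image.1 hp'
    have : u p' i = none := by
      rcases Finset.mem_union.1 hp with h | h
      exacts [hnone a _ (Finset.mem_filter.1 h).2, hnone b _ (Finset.mem_filter.1 h).2]
    simp [u] at this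
  calc A.card + B.card = (A ∪ B).card + (A ∩ B).card := (Finset.card_union_add_card_inter A B).symm
    _ = (A ∪ B).card + ((A ∩ B).image u).card := by rw [Finset.card_image_of_injOn hinj]
    _ = ((A ∪ B) ∪ (A ∩ B).image u).card := (Finset.card_union_of_disjoint hdisj).symm
    _ ≤ _ := by
      refine Finset.card_le_card fun p hp => Finset.mem_filter.2 ⟨Finset.mem_univ _, ?_⟩
      rcases Finset.mem_union.1 hp with h | h
      · rcases Finset.mem_union.1 h with h | h
        exacts [(Finset.mem_filter.1 h).2.mono (Finset.filter_subset _ _),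
          (Finset.mem_filter.1 h).2.mono (Finset.filter_subset _ _)]
      · obtain ⟨p', hp', rfl⟩ := Finset.mem_image.1 h
        have hpa := (Finset.mem_filter.1 (Finset.mem_inter.1 hp').1).2
        have hpb := (Finset.mem_filter.1 (Finset.mem_inter.1 hp').2).2
        refine ⟨fun j q hq => ?_, fun σ => ?_⟩
        · by_cases hj : j = i
          · subst hj
            simp only [u, Function.update_self, Option.some.injEq] at hq
            subst hq; exact hab
          · exact hpa.1 j q (by simpa [u, Function.update_of_ne hj] using hq)
        · by_cases hσ : σ i
          · obtain ⟨w, hw, h⟩ := hpa.2 σ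
            refine ⟨w, (Finset.mem_filter.1 hw).1, fun j q hq => ?_⟩
            by_cases hj : j = i
            · subst hj
              simp only [u, Function.update_self, Option.some.injEq] at hq
              subst hq
              exact ⟨fun _ => (Finset.mem_filter.1 hw).2, fun h => absurd hσ h⟩
            · exact h j q (by simpa [u, Function.update_of_ne hj] using hq)
          · obtain ⟨w, hw, h⟩ := hpb.2 σ
            refine ⟨w, (Finset.mem_filter.1 hw).1, fun j q hq => ?_⟩
            by_cases hj : j = i
            · subst hj
              simp only [u, Function.update_self, Option.some.injEq] at hq
              subst hq
              exact ⟨fun h => absurd h hσ, fun _ => (Finset.mem_filter.1 hw).2⟩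
            · exact h j q (by simpa [u, Function.update_of_ne hj] using hq)

open Classical in
/-- Words which are pairwise far at a proportion `η` of the indices can be split, according to
their symbol at a suitable index, into two large subfamilies with far symbols. -/
theorem exists_split [Fintype ι] [Fintype α] {far : α → α → Prop} {η : ℝ} (hη : 0 < η)
    (F : Finset (ι → α)) (hF : 2 ≤ F.card)
    (hsep : ∀ w ∈ F, ∀ w' ∈ F, w ≠ w' → η * Fintype.card ι ≤
      ((Finset.univ.filter fun i => far (w i) (w' i)).card : ℝ)) :
    ∃ i a b, far a b ∧
      η / (4 * (Fintype.card α : ℝ) ^ 2) * F.card ≤ ((F.filter fun w => w i = a).card : ℝ) ∧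
      η / (4 * (Fintype.card α : ℝ) ^ 2) * F.card ≤ ((F.filter fun w => w i = b).card : ℝ) := by
  set θ := η / (4 * (Fintype.card α : ℝ) ^ 2) with hθ
  -- Double counting of far pairs. If one class is always small, each index sees at most `|α|² θ
  -- |F|² = η |F|² / 4` far ordered pairs, while separation forces an average of at least `η (|F|² -
  -- |F|) ≥ η |F|² / 2` per index.
  by_contra! hcon
  obtain ⟨w₁, hw₁, w₂, hw₂, hne⟩ := Finset.one_lt_card.1 hF
  obtain ⟨i₀, -⟩ := Function.ne_iff.1 hne
  have hn : 0 < Fintype.card ι := Fintype.card_pos_iff.2 ⟨i₀⟩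
  have hm : 0 < Fintype.card α := Fintype.card_pos_iff.2 ⟨w₁ i₀⟩
  have hF2 : (2 : ℝ) ≤ F.card := by exact_mod_cast hF
  have hprod : ∀ i a b, far a b → ((F.filter fun w => w i = a).card : ℝ) *
      ((F.filter fun w => w i = b).card : ℝ) ≤ θ * F.card ^ 2 := by
    intro i a b hab
    have hle : ∀ e : α, ((F.filter fun w => w i = e).card : ℝ) ≤ F.card := fun e => by
      exact_mod_cast Finset.card_filter_le _ _
    by_cases h : θ * F.card ≤ ((F.filter fun w => w i = a).card : ℝ)
    · have h2 := hcon i a b hab h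
      calc _ ≤ (F.card : ℝ) * (θ * F.card) := mul_le_mul (hle a) h2.le (by positivity) (by positivity)
        _ = _ := by ring
    · calc _ ≤ (θ * F.card) * (F.card : ℝ) := mul_le_mul (not_le.1 h).le (hle b) (by positivity) (by positivity)
        _ = _ := by ring
  have hupper : ∀ i, (((F ×ˢ F).filter fun q => far (q.1 i) (q.2 i)).card : ℝ) ≤
      (Fintype.card α : ℝ) ^ 2 * (θ * F.card ^ 2) := by
    intro i
    have hsub : ((F ×ˢ F).filter fun q => far (q.1 i) (q.2 i)) ⊆
        (Finset.univ.filter fun r : α × α => far r.1 r.2).biUnion fun r =>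
          (F.filter fun w => w i = r.1) ×ˢ (F.filter fun w => w i = r.2) := by
      intro q hq
      simp only [Finset.mem_filter, Finset.mem_product] at hq
      simp only [Finset.mem_biUnion, Finset.mem_filter, Finset.mem_univ, true_and,
        Finset.mem_product]
      exact ⟨(q.1 i, q.2 i), hq.2, ⟨hq.1.1, rfl⟩, hq.1.2, rfl⟩
    have h1 := (Finset.card_le_card hsub).trans Finset.card_biUnion_le
    calc (((F ×ˢ F).filter fun q => far (q.1 i) (q.2 i)).card : ℝ)
        ≤ ∑ r ∈ Finset.univ.filter (fun r : α × α => far r.1 r.2),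
          (((F.filter fun w => w i = r.1) ×ˢ (F.filter fun w => w i = r.2)).card : ℝ) := by
          exact_mod_cast h1
      _ ≤ ∑ r ∈ Finset.univ.filter (fun r : α × α => far r.1 r.2), θ * F.card ^ 2 := by
          refine Finset.sum_le_sum fun r hr => ?_
          rw [Finset.card_product]
          push_cast
          exact hprod i r.1 r.2 (Finset.mem_filter.1 hr).2
      _ ≤ ∑ r : α × α, θ * F.card ^ 2 := by
          refine Finset.sum_le_sum_of_subset_of_nonneg (Finset.filter_subset _ _) fun _ _ _ => ?_
          positivity
      _ = _ := by
          rw [Finset.sum_const, nsmul_eq_mul, Finset.card_univ, Fintype.card_prod]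
          push_cast
          ring
  have hlower : ((F.card : ℝ) * F.card - F.card) * (η * Fintype.card ι) ≤
      ∑ i : ι, (((F ×ˢ F).filter fun q => far (q.1 i) (q.2 i)).card : ℝ) := by
    have hoff : (F.offDiag.card : ℝ) = (F.card : ℝ) * F.card - F.card := by
      rw [Finset.offDiag_card, Nat.cast_sub (Nat.le_mul_self _)]; push_cast; ring
    calc ((F.card : ℝ) * F.card - F.card) * (η * Fintype.card ι)
        = ∑ q ∈ F.offDiag, η * Fintype.card ι := by rw [Finset.sum_const, nsmul_eq_mul, hoff]
      _ ≤ ∑ q ∈ F.offDiag, ((Finset.univ.filter fun i => far (q.1 i) (q.2 i)).card : ℝ) := by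
          refine Finset.sum_le_sum fun q hq => ?_
          obtain ⟨h1, h2, h3⟩ := Finset.mem_offDiag.1 hq
          exact hsep _ h1 _ h2 h3
      _ ≤ ∑ q ∈ F ×ˢ F, ((Finset.univ.filter fun i => far (q.1 i) (q.2 i)).card : ℝ) := by
          refine Finset.sum_le_sum_of_subset_of_nonneg (fun q hq => ?_) fun _ _ _ => by positivity
          obtain ⟨h1, h2, h3⟩ := Finset.mem_offDiag.1 hq
          exact Finset.mem_product.2 ⟨h1, h2⟩
      _ = _ := by
          simp only [Finset.card_filter]
          push_cast
          exact Finset.sum_comm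
  have h := hlower.trans (Finset.sum_le_sum fun i _ => hupper i)
  rw [Finset.sum_const, nsmul_eq_mul, Finset.card_univ] at h
  have hm' : (0 : ℝ) < Fintype.card α := by exact_mod_cast hm
  have hn' : (0 : ℝ) < Fintype.card ι := by exact_mod_cast hn
  have h4 : (Fintype.card α : ℝ) ^ 2 * (θ * F.card ^ 2) = η / 4 * F.card ^ 2 := by
    rw [hθ]; field_simp
  rw [h4] at h
  have h5 : 0 < η * Fintype.card ι := by positivity
  have h6 : (F.card : ℝ) * F.card - F.card ≤ 1 / 4 * F.card ^ 2 := by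
    refine le_of_mul_le_mul_right ?_ h5
    linarith
  nlinarith

-- Splitting repeatedly gives a binary tree of depth `k`: each level costs a factor `θ` in size, and
-- `card_shattered_add_le` doubles the count of patterns. At a leaf a nonempty family shatters the
-- empty pattern.
open Classical in
theorem two_pow_le_card_shattered [Fintype ι] [Fintype α] {far : α → α → Prop}
    (hirr : ∀ a, ¬ far a a) {η : ℝ} (hη : 0 < η) (hη1 : η ≤ 1) (k : ℕ) (F : Finset (ι → α))
    (hsep : ∀ w ∈ F, ∀ w' ∈ F, w ≠ w' → η * Fintype.card ι ≤
      ((Finset.univ.filter fun i => far (w i) (w' i)).card : ℝ))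
    (hF : 1 ≤ (η / (4 * (Fintype.card α : ℝ) ^ 2)) ^ k * F.card) :
    2 ^ k ≤ (Finset.univ.filter (Shatters far F)).card := by
  induction k generalizing F with
  | zero =>
    simp only [pow_zero, one_mul, Nat.one_le_cast] at hF
    obtain ⟨w, hw⟩ := Finset.card_pos.1 hF
    exact Finset.card_pos.2 ⟨fun _ => none, Finset.mem_filter.2 ⟨Finset.mem_univ _,
      by simp, fun _ => ⟨w, hw, by simp⟩⟩⟩
  | succ k ih =>
    set θ := η / (4 * (Fintype.card α : ℝ) ^ 2) with hθ
    have hθ0 : 0 ≤ θ := by positivity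
    have hθ1 : θ ≤ 1 / 4 := by
      rcases Nat.eq_zero_or_pos (Fintype.card α) with h | h
      · simp [hθ, h]
      · have : (1 : ℝ) ≤ Fintype.card α := by exact_mod_cast h
        rw [hθ, div_le_iff₀ (by positivity)]
        nlinarith
    have hk : θ ^ k ≤ 1 := pow_le_one₀ hθ0 (by linarith)
    have hF2 : 2 ≤ F.card := by
      have : (2 : ℝ) ≤ F.card := by
        rw [pow_succ] at hF
        have h1 : θ ^ k * θ ≤ 1 * (1 / 4) := by gcongr
        have h2 : θ ^ k * θ * F.card ≤ 1 * (1 / 4) * F.card := by gcongr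
        linarith
      exact_mod_cast this
    obtain ⟨i, a, b, hab, ha, hb⟩ := exists_split hη F hF2 hsep
    have hsub : ∀ e : α, θ * F.card ≤ ((F.filter fun w => w i = e).card : ℝ) →
        2 ^ k ≤ (Finset.univ.filter (Shatters far (F.filter fun w => w i = e))).card := by
      intro e he
      refine ih _ (fun w hw w' hw' => hsep w (Finset.filter_subset _ _ hw) w'
        (Finset.filter_subset _ _ hw')) ?_
      calc 1 ≤ θ ^ (k + 1) * F.card := hF
        _ = θ ^ k * (θ * F.card) := by ring
        _ ≤ _ := by gcongr
    have := card_shattered_add_le hirr F hab (i := i)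
    have h1 := hsub a ha
    have h2 := hsub b hb
    rw [pow_succ]
    omega

open Classical in
/-- A family of words, any two of which are far somewhere, contains a large subfamily any two
members of which are far at a positive proportion of the indices. -/
theorem exists_subfamily_pairwise_far {ι : Type} [Fintype ι] [Nonempty ι] [Fintype α]
    {far far' : α → α → Prop} (hirr : ∀ a, ¬ far a a)
    (hsymm : ∀ a b, far a b → far b a)
    (htri : ∀ a b z, far' a b → far z a ∨ far z b) {η : ℝ} (hη : 0 < η) (F : Finset (ι → α))
    (hF : ∀ w ∈ F, ∀ w' ∈ F, w ≠ w' → ∃ i, far' (w i) (w' i)) :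
    ∃ G ⊆ F, (∀ w ∈ G, ∀ w' ∈ G, w ≠ w' → η * Fintype.card ι ≤
      ((Finset.univ.filter fun i => far (w i) (w' i)).card : ℝ)) ∧
      F.card ≤ G.card * (Finset.univ.filter fun p : ι → Option α =>
        ((Finset.univ.filter fun i => (p i).isSome).card : ℝ) ≤ η * Fintype.card ι).card := by
  let good : Finset (ι → α) → Prop := fun G => ∀ w ∈ G, ∀ w' ∈ G, w ≠ w' →
    η * Fintype.card ι ≤ ((Finset.univ.filter fun i => far (w i) (w' i)).card : ℝ)
  -- A separated subfamily of maximal size is a net: otherwise a word of `F` could be added.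
  obtain ⟨G, hG, hmax⟩ := Finset.exists_max_image (F.powerset.filter good) Finset.card
    ⟨∅, by simp [good]⟩
  obtain ⟨hGF, hgood⟩ := Finset.mem_filter.1 hG
  rw [Finset.mem_powerset] at hGF
  refine ⟨G, hGF, hgood, ?_⟩
  have hcover : ∀ v ∈ F, ∃ w ∈ G,
      ((Finset.univ.filter fun i => far (w i) (v i)).card : ℝ) ≤ η * Fintype.card ι := by
    intro v hv
    by_contra! hcon
    have hvG : v ∉ G := fun h => by
      have := hcon v h
      simp only [hirr, Finset.filter_false, Finset.card_empty, Nat.cast_zero] at this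
      exact absurd this (not_lt.2 (by positivity))
    have hcomm : ∀ w : ι → α, (Finset.univ.filter fun i => far (v i) (w i)) =
        Finset.univ.filter fun i => far (w i) (v i) := fun w =>
      Finset.filter_congr fun i _ => ⟨hsymm _ _, hsymm _ _⟩
    have := hmax (insert v G) (Finset.mem_filter.2 ⟨Finset.mem_powerset.2
      (Finset.insert_subset hv hGF), fun w hw w' hw' hne => by
        rcases Finset.mem_insert.1 hw with rfl | hwG
        · rcases Finset.mem_insert.1 hw' with rfl | hwG'
          · exact absurd rfl hne
          · rw [hcomm]; exact (hcon w' hwG').le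
        · rcases Finset.mem_insert.1 hw' with rfl | hwG'
          · exact (hcon w hwG).le
          · exact hgood w hwG w' hwG' hne⟩)
    rw [Finset.card_insert_of_notMem hvG] at this
    omega
  set D := Finset.univ.filter fun p : ι → Option α =>
        ((Finset.univ.filter fun i => (p i).isSome).card : ℝ) ≤ η * Fintype.card ι with hD
  choose! c hcG hc using hcover
  let code : (ι → α) → (ι → α) × (ι → Option α) := fun v =>
    (c v, fun i => if far (c v i) (v i) then some (v i) else none)
  rw [← Finset.card_product]
  refine Finset.card_le_card_of_injOn code (fun v hv => ?_) fun v hv v' hv' heq => ?_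
  · refine Finset.mem_coe.2 (Finset.mem_product.2 ⟨hcG v hv, Finset.mem_filter.2
      ⟨Finset.mem_univ _, ?_⟩⟩)
    have : (Finset.univ.filter fun i => ((code v).2 i).isSome) =
        Finset.univ.filter fun i => far (c v i) (v i) :=
      Finset.filter_congr fun i _ => by simp only [code]; split_ifs with h <;> simp [h]
    rw [this]
    exact hc v hv
  · by_contra hne
    obtain ⟨i, hi⟩ := hF v hv v' hv' hne
    have h1 : c v = c v' := congrArg Prod.fst heq
    have h2 := congrFun (congrArg Prod.snd heq) i
    have hvi : v i = v' i := by
      simp only [code, ← h1] at h2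
      rcases htri _ _ (c v i) hi with h | h
      · rw [if_pos h] at h2
        split_ifs at h2 with h'
        exact Option.some_injective _ h2
      · rw [if_pos h] at h2
        split_ifs at h2 with h'
        exact Option.some_injective _ h2
    rw [hvi] at hi
    rcases htri _ _ (v' i) hi with h | h <;> exact hirr _ h

/-- An exponentially large family of words, any two of which are far somewhere, shatters a set of
positive proportion of the indices. -/
theorem exists_shattered [Fintype α] {far far' : α → α → Prop} (hirr : ∀ a, ¬ far a a)
    (hsymm : ∀ a b, far a b → far b a)
    (htri : ∀ a b z, far' a b → far z a ∨ far z b) {c : ℝ} (hc : 0 < c) :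
    ∃ κ : ℝ, 0 < κ ∧ ∀ᶠ n : ℕ in atTop, ∀ F : Finset (Fin n → α), Real.exp (c * n) ≤ F.card →
      (∀ w ∈ F, ∀ w' ∈ F, w ≠ w' → ∃ i, far' (w i) (w' i)) →
      ∃ p, Shatters far F p ∧
        κ * n ≤ ((Finset.univ.filter fun i => (p i).isSome).card : ℝ) := by
  classical
  rcases isEmpty_or_nonempty α with hα | hα
  · refine ⟨1, one_pos, (eventually_gt_atTop 0).mono fun n hn F hF _ => ?_⟩
    have : F.Nonempty := by
      rw [← Finset.card_pos]
      exact_mod_cast (Real.exp_pos (c * n)).trans_le hF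
    obtain ⟨w, -⟩ := this
    exact hα.elim (w ⟨0, hn⟩)
  obtain ⟨η, hη, hη1, hsparse⟩ := exists_card_sparse_le α (half_pos hc)
  set θ := η / (4 * (Fintype.card α : ℝ) ^ 2) with hθ
  have hm : (1 : ℝ) ≤ Fintype.card α := by exact_mod_cast Fintype.card_pos
  have hθ0 : 0 < θ := by positivity
  have hθ1 : θ < 1 := by
    rw [hθ, div_lt_iff₀ (by positivity)]
    nlinarith
  set Λ := -Real.log θ with hΛ
  have hΛ0 : 0 < Λ := neg_pos.2 (Real.log_neg hθ0 hθ1)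
  have hlog2 : 0 < Real.log 2 := Real.log_pos one_lt_two
  -- Chosen so that there are at most `2 ^ (c n / (4 Λ))` patterns with support of size at most `κ
  -- n`, whereas about `2 ^ (c n / (2 Λ))` will be shattered.
  obtain ⟨κ, hκ, -, hsparse'⟩ := exists_card_sparse_le (α × α)
    (c := Real.log 2 * (c / (4 * Λ))) (by positivity)
  have hlarge : ∀ᶠ n : ℕ in atTop, 1 < c / (4 * Λ) * n :=
    (tendsto_natCast_atTop_atTop.const_mul_atTop (by positivity)).eventually_gt_atTop 1
  refine ⟨κ, hκ, ?_⟩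
  filter_upwards [hlarge, eventually_gt_atTop 0] with n hn hn0 F hF hsep
  have : Nonempty (Fin n) := ⟨⟨0, hn0⟩⟩
  obtain ⟨G, hGF, hG, hcard⟩ := exists_subfamily_pairwise_far hirr hsymm htri hη F hsep
  have hs := hsparse (Fin n)
  have hs' := hsparse' (Fin n)
  simp only [Fintype.card_fin] at hs hs' hcard
  have hGcard : Real.exp (c / 2 * n) ≤ G.card := by
    have h1 : Real.exp (c * n) ≤ G.card * Real.exp (c / 2 * n) := by
      refine hF.trans ((Nat.cast_le.2 hcard).trans ?_)
      push_cast
      gcongr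
    have h2 : Real.exp (c * n) = Real.exp (c / 2 * n) * Real.exp (c / 2 * n) := by
      rw [← Real.exp_add]; ring_nf
    rw [h2] at h1
    exact le_of_mul_le_mul_right h1 (Real.exp_pos _)
  -- The largest depth for which `θ ^ k * exp (c / 2 * n) ≥ 1`. Rounding costs less than one, which
  -- `hlarge` absorbs.
  set k := ⌊c * n / (2 * Λ)⌋₊ with hk
  have hkle : (k : ℝ) ≤ c * n / (2 * Λ) := Nat.floor_le (by positivity)
  have hklt : c * n / (2 * Λ) < k + 1 := Nat.lt_floor_add_one _
  clear_value k
  have hpow : θ ^ k = Real.exp (-(Λ * k)) := by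
    rw [← Real.exp_log hθ0, ← Real.exp_nat_mul]
    congr 1
    rw [hΛ]
    ring
  have htree := two_pow_le_card_shattered hirr hη hη1 k G hG (by
    rw [← hθ, hpow]
    have : Λ * k ≤ c / 2 * n := by
      calc Λ * k ≤ Λ * (c * n / (2 * Λ)) := by gcongr
        _ = c / 2 * n := by field_simp
    calc (1 : ℝ) = Real.exp 0 := Real.exp_zero.symm
      _ ≤ Real.exp (-(Λ * k) + c / 2 * n) := Real.exp_le_exp.2 (by linarith)
      _ = Real.exp (-(Λ * k)) * Real.exp (c / 2 * n) := Real.exp_add _ _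
      _ ≤ _ := by gcongr)
  by_contra! hcon
  have hfin : (2 : ℝ) ^ k ≤ Real.exp (Real.log 2 * (c / (4 * Λ)) * n) := by
    have h0 : ((2 ^ k : ℕ) : ℝ) ≤ _ := Nat.cast_le.2 htree
    rw [Nat.cast_pow, Nat.cast_ofNat] at h0
    refine h0.trans (le_trans (Nat.cast_le.2 (Finset.card_le_card fun p hp => ?_)) hs')
    refine Finset.mem_filter.2 ⟨@Finset.mem_univ _ (_) _, ?_⟩
    convert (hcon p ((Finset.mem_filter.1 hp).2.mono hGF)).le
  have h2k : (2 : ℝ) ^ k = Real.exp (Real.log 2 * k) := by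
    rw [mul_comm, Real.exp_nat_mul, Real.exp_log two_pos]
  rw [h2k, Real.exp_le_exp, mul_assoc] at hfin
  have h3 := le_of_mul_le_mul_left hfin hlog2
  have h4 : c * n / (2 * Λ) = 2 * (c / (4 * Λ) * n) := by field_simp; ring
  linarith

end Words

/-! ### From dense finite sets to one infinite set with a density. -/

section Density

open Classical in
/-- The maximal size of a subset of `{0, …, n - 1}` with the property `P`. -/
noncomputable def maxCard (P : Finset ℤ → Prop) (n : ℕ) : ℕ :=
  ((Finset.Ico (0 : ℤ) n).powerset.filter P).sup Finset.card

variable {P : Finset ℤ → Prop}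

theorem exists_card_eq_maxCard (h0 : P ∅) (n : ℕ) :
    ∃ J, P J ∧ J ⊆ Finset.Ico (0 : ℤ) n ∧ J.card = maxCard P n := by
  classical
  obtain ⟨J, hJ, h⟩ := Finset.exists_mem_eq_sup ((Finset.Ico (0 : ℤ) n).powerset.filter P)
    ⟨∅, by simpa using h0⟩ Finset.card
  rw [Finset.mem_filter, Finset.mem_powerset] at hJ
  refine ⟨J, hJ.2, hJ.1, ?_⟩
  unfold maxCard
  convert h.symm

theorem card_le_maxCard (hshift : ∀ J (k : ℤ), P J → P (J.image (· + k))) {J : Finset ℤ} (hJ : P J)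
    {a : ℤ} {n : ℕ} (hsub : J ⊆ Finset.Ico a (a + n)) : J.card ≤ maxCard P n := by
  classical
  have hinj : Function.Injective (fun x : ℤ => x + -a) := add_left_injective _
  rw [← Finset.card_image_of_injective J hinj]
  refine Finset.le_sup (f := Finset.card) (Finset.mem_filter.2 ⟨?_, hshift J (-a) hJ⟩)
  rw [Finset.mem_powerset]
  intro x hx
  obtain ⟨y, hy, rfl⟩ := Finset.mem_image.1 hx
  have := Finset.mem_Ico.1 (hsub hy)
  rw [Finset.mem_Ico]
  constructor <;> linarith

theorem subadditive_maxCard (h0 : P ∅) (hmono : ∀ J J', J ⊆ J' → P J' → P J)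
    (hshift : ∀ J (k : ℤ), P J → P (J.image (· + k))) :
    Subadditive fun n => (maxCard P n : ℝ) := by
  classical
  intro m n
  obtain ⟨J, hJ, hsub, hcard⟩ := exists_card_eq_maxCard h0 (m + n)
  have h1 : (J.filter (· < (m : ℤ))).card ≤ maxCard P m :=
    card_le_maxCard hshift (hmono _ _ (Finset.filter_subset _ _) hJ) (a := 0) fun x hx => by
      rw [Finset.mem_filter] at hx
      have := Finset.mem_Ico.1 (hsub hx.1)
      rw [Finset.mem_Ico]
      omega
  have h2 : (J.filter (¬ · < (m : ℤ))).card ≤ maxCard P n :=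
    card_le_maxCard hshift (hmono _ _ (Finset.filter_subset _ _) hJ) (a := m) fun x hx => by
      rw [Finset.mem_filter] at hx
      have := Finset.mem_Ico.1 (hsub hx.1)
      rw [Finset.mem_Ico]
      push_cast at this
      omega
  have h3 := Finset.card_filter_add_card_filter_not (s := J) (· < (m : ℤ))
  simp only
  rw [← hcard, ← h3]
  exact_mod_cast add_le_add h1 h2

/-- The rising sun argument: a dense set has a translate which is dense in all short initial
segments. -/
theorem exists_dense_initial_segments (hmono : ∀ J J', J ⊆ J' → P J' → P J)
    (hshift : ∀ J (k : ℤ), P J → P (J.image (· + k))) (h0 : P ∅) {d : ℝ}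
    (hd : ∀ n : ℕ, d * n ≤ maxCard P n) (m : ℕ) (hm : 0 < m) :
    ∃ J, P J ∧ (∀ i ∈ J, 0 ≤ i) ∧
      ∀ n ≤ m, (d - 1 / m) * n ≤ ((J.filter (· < (n : ℤ))).card : ℝ) := by
  classical
  have hm' : (0 : ℝ) < m := by exact_mod_cast hm
  rcases le_or_gt (d - 1 / m) 0 with hneg | hpos
  · exact ⟨∅, h0, by simp, fun n _ => by
      simpa using mul_nonpos_of_nonpos_of_nonneg hneg (Nat.cast_nonneg n)⟩
  set ε : ℝ := d - 1 / m with hε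
  obtain ⟨J, hJ, hsub, hcard⟩ := exists_card_eq_maxCard h0 (m * m)
  -- The excess of `J` over slope `ε` on initial segments. Starting from a minimum point `p` of `S`,
  -- every later segment has density at least `ε`.
  let S : ℕ → ℝ := fun k => ((J.filter (· < (k : ℤ))).card : ℝ) - ε * k
  obtain ⟨p, hp, hmin⟩ := Finset.exists_min_image (Finset.range (m * m + 1)) S ⟨0, by simp⟩
  have hpN : p ≤ m * m := Nat.lt_succ_iff.1 (Finset.mem_range.1 hp)
  have hdiff : ∀ k, p ≤ k → ((J.filter (· < (k : ℤ))).card : ℝ) =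
      (J.filter (· < (p : ℤ))).card + (J.filter fun x => (p : ℤ) ≤ x ∧ x < k).card := by
    intro k hk
    rw [← Nat.cast_add, ← Finset.card_union_of_disjoint]
    · congr 2
      ext x
      simp only [Finset.mem_filter, Finset.mem_union]
      constructor
      · intro h
        by_cases hx : x < p
        · exact Or.inl ⟨h.1, hx⟩
        · exact Or.inr ⟨h.1, by omega, h.2⟩
      · rintro (h | h)
        · exact ⟨h.1, by omega⟩
        · exact ⟨h.1, h.2.2⟩
    · rw [Finset.disjoint_left]
      intro x hx hx'
      simp only [Finset.mem_filter] at hx hx'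
      omega
  have hSp : S p ≤ 0 := by
    refine (hmin 0 (by simp)).trans (le_of_eq ?_)
    have : J.filter (· < ((0 : ℕ) : ℤ)) = ∅ := by
      rw [Finset.filter_eq_empty_iff]
      intro x hx
      have := (Finset.mem_Ico.1 (hsub hx)).1
      push_cast
      omega
    simp only [S]
    rw [this]
    simp
  have hSN : (m : ℝ) ≤ S (m * m) := by
    have : J.filter (· < ((m * m : ℕ) : ℤ)) = J := by
      rw [Finset.filter_eq_self]
      intro x hx
      exact (Finset.mem_Ico.1 (hsub hx)).2
    simp only [S, this, hcard]
    have h1 := hd (m * m)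
    have h2 : ε * ((m * m : ℕ) : ℝ) = d * ((m * m : ℕ) : ℝ) - m := by
      rw [hε]; push_cast; field_simp
    linarith
  -- The excess grows by at least `m` between `p` and `m * m`, hence `J` has at least `m` elements
  -- there. This leaves room for all segments of length at most `m`.
  have hpm : p + m ≤ m * m := by
    have h1 := hdiff (m * m) hpN
    have h2 : ((J.filter fun x => (p : ℤ) ≤ x ∧ x < ((m * m : ℕ) : ℤ)).card : ℝ) ≤
        (m * m : ℕ) - p := by
      have : (J.filter fun x => (p : ℤ) ≤ x ∧ x < ((m * m : ℕ) : ℤ)).card ≤ m * m - p := by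
        refine (Finset.card_le_card (t := Finset.Ico (p : ℤ) ((m * m : ℕ) : ℤ))
          fun x hx => ?_).trans (by rw [Int.card_Ico]; omega)
        rw [Finset.mem_Ico]
        exact (Finset.mem_filter.1 hx).2
      rw [← Nat.cast_sub hpN]
      exact_mod_cast this
    have h3 : ε * p ≤ ε * ((m * m : ℕ) : ℝ) := by gcongr
    simp only [S] at hSp hSN
    have : (p : ℝ) + m ≤ ((m * m : ℕ) : ℝ) := by linarith
    exact_mod_cast this
  refine ⟨(J.filter fun x => (p : ℤ) ≤ x).image (· + -(p : ℤ)),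
    hshift _ _ (hmono _ _ (Finset.filter_subset _ _) hJ), fun i hi => ?_, fun n hn => ?_⟩
  · obtain ⟨y, hy, rfl⟩ := Finset.mem_image.1 hi
    have := (Finset.mem_filter.1 hy).2
    omega
  · have heq : ((J.filter fun x => (p : ℤ) ≤ x).image (· + -(p : ℤ))).filter (· < (n : ℤ)) =
        (J.filter fun x => (p : ℤ) ≤ x ∧ x < ((p + n : ℕ) : ℤ)).image (· + -(p : ℤ)) := by
      ext x
      simp only [Finset.mem_filter, Finset.mem_image]
      constructor
      · rintro ⟨⟨y, hy, rfl⟩, hx⟩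
        exact ⟨y, ⟨hy.1, hy.2, by push_cast; omega⟩, rfl⟩
      · rintro ⟨y, hy, rfl⟩
        exact ⟨⟨y, ⟨hy.1, hy.2.1⟩, rfl⟩, by have := hy.2.2; push_cast at this; omega⟩
    rw [heq, Finset.card_image_of_injective _ (add_left_injective _)]
    have h1 := hdiff (p + n) (Nat.le_add_right _ _)
    have h2 := hmin (p + n) (Finset.mem_range.2 (by omega))
    simp only [S] at h2
    push_cast at h1 h2
    push_cast
    linarith

/-- A hereditary translation invariant family of finite sets of integers with members of positive
density in arbitrarily long intervals contains all finite subsets of some set of positive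
density. -/
theorem exists_hasDensity (hmono : ∀ J J', J ⊆ J' → P J' → P J)
    (hshift : ∀ J (k : ℤ), P J → P (J.image (· + k))) {κ : ℝ} (hκ : 0 < κ)
    (hbig : ∃ᶠ n : ℕ in atTop, ∃ J, P J ∧ J ⊆ Finset.Ico (0 : ℤ) n ∧ κ * n ≤ J.card) :
    ∃ I : Set ℤ, (∃ d : ℝ, 0 < d ∧ HasDensity I d) ∧ ∀ J : Finset ℤ, (J : Set ℤ) ⊆ I → P J := by
  classical
  have h0 : P ∅ := by
    obtain ⟨n, J, hJ, -⟩ := hbig.exists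
    exact hmono _ _ (Finset.empty_subset _) hJ
  have hsubadd := subadditive_maxCard h0 hmono hshift
  have hbdd : BddBelow (range fun n : ℕ => (maxCard P n : ℝ) / n) :=
    ⟨0, by rintro _ ⟨n, rfl⟩; positivity⟩
  set d := hsubadd.lim with hd
  have hlim : Tendsto (fun n : ℕ => (maxCard P n : ℝ) / n) atTop (𝓝 d) := hsubadd.tendsto_lim hbdd
  have hdle : ∀ n : ℕ, d * n ≤ maxCard P n := by
    intro n
    rcases Nat.eq_zero_or_pos n with rfl | hn
    · simp
    · have := hsubadd.lim_le_div hbdd hn.ne'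
      rwa [le_div_iff₀ (by exact_mod_cast hn)] at this
  have hd0 : 0 < d := by
    refine hκ.trans_le (ge_of_tendsto_of_frequently hlim ?_)
    refine (hbig.and_eventually (eventually_gt_atTop 0)).mono ?_
    rintro n ⟨⟨J, hJ, hsub, hcard⟩, hn⟩
    rw [le_div_iff₀ (by exact_mod_cast hn)]
    refine hcard.trans ?_
    exact_mod_cast card_le_maxCard hshift hJ (a := 0) (by simpa using hsub)
  choose! J hJP hJ0 hJ using exists_dense_initial_segments hmono hshift h0 hdle
  let 𝒰 : Ultrafilter ℕ := hyperfilter ℕ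
  have h𝒰 : (𝒰 : Filter ℕ) ≤ atTop := by
    rw [← Nat.cofinite_eq_atTop]; exact hyperfilter_le_cofinite
  -- The ultrafilter limit of the sets `J m`. On any finite window it agrees with `J m` for almost
  -- all `m`, so it inherits both `P` on finite subsets and the lower bound `d` on initial segments.
  let I : Set ℤ := {i | ∀ᶠ m in 𝒰, i ∈ J m}
  have hpos : ∀ᶠ m in (𝒰 : Filter ℕ), 0 < m := h𝒰 (eventually_gt_atTop 0)
  have hI0 : ∀ i ∈ I, 0 ≤ i := by
    intro i hi
    obtain ⟨m, hm, hm0⟩ := (Eventually.and hi hpos).exists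
    exact hJ0 m hm0 i hm
  have hfin : ∀ A : Finset ℤ, (A : Set ℤ) ⊆ I → P A := by
    intro A hA
    have h1 : ∀ᶠ m in (𝒰 : Filter ℕ), ∀ i ∈ A, i ∈ J m :=
      (Filter.eventually_all_finset A).2 fun i hi => hA hi
    obtain ⟨m, hm, hm0⟩ := (h1.and hpos).exists
    exact hmono _ _ hm (hJP m hm0)
  let W : ℕ → Finset ℤ := fun n => (Finset.Ico (0 : ℤ) n).filter (· ∈ I)
  have hWP : ∀ n, ((W n).card : ℝ) ≤ maxCard P n := by
    intro n
    have : P (W n) := hfin _ fun i hi => (Finset.mem_filter.1 hi).2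
    exact_mod_cast card_le_maxCard hshift this (a := 0) (n := n)
      (by rw [zero_add]; exact Finset.filter_subset _ _)
  have hWd : ∀ n : ℕ, d * n ≤ (W n).card := by
    intro n
    have hev : ∀ᶠ m : ℕ in (𝒰 : Filter ℕ), (d - 1 / (m : ℝ)) * n ≤ (W n).card := by
      have h1 : ∀ᶠ m in (𝒰 : Filter ℕ), ∀ i ∈ Finset.Ico (0 : ℤ) n, i ∈ J m → i ∈ I := by
        refine (Filter.eventually_all_finset _).2 fun i _ => ?_
        by_cases hi : i ∈ I
        · exact Eventually.of_forall fun _ _ => hi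
        · have : ∀ᶠ m in (𝒰 : Filter ℕ), ¬ i ∈ J m := Ultrafilter.eventually_not.2 hi
          exact this.mono fun m hm h => absurd h hm
      filter_upwards [h1, hpos, h𝒰 (eventually_ge_atTop n)] with m hm hm0 hmn
      refine (hJ m hm0 n hmn).trans ?_
      norm_cast
      refine Finset.card_le_card fun i hi => ?_
      obtain ⟨hi1, hi2⟩ := Finset.mem_filter.1 hi
      have hmem : i ∈ Finset.Ico (0 : ℤ) n := Finset.mem_Ico.2 ⟨hJ0 m hm0 i hi1, hi2⟩
      exact Finset.mem_filter.2 ⟨hmem, hm i hmem hi1⟩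
    have htend : Tendsto (fun m : ℕ => (d - 1 / (m : ℝ)) * n) 𝒰 (𝓝 (d * n)) := by
      have := ((tendsto_one_div_atTop_nhds_zero_nat (𝕜 := ℝ)).const_sub d).mul_const (n : ℝ)
      simp only [sub_zero] at this
      exact this.mono_left h𝒰
    exact le_of_tendsto htend hev
  -- `I` has no negative elements, so density `d` along `{0, …, n}` becomes `d / 2` along `{-n, …,
  -- n}`. The upper bound comes from `maxCard`, whose ratios also tend to `d`.
  refine ⟨I, ⟨d / 2, half_pos hd0, ?_⟩, hfin⟩
  have hcount : ∀ n : ℕ, (I ∩ Set.Icc (-(n : ℤ)) (n : ℤ)).ncard = (W (n + 1)).card := by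
    intro n
    rw [← Set.ncard_coe_finset]
    congr 1
    ext i
    simp only [W, Set.mem_inter_iff, Set.mem_Icc, Finset.coe_filter, Finset.mem_Ico,
      Set.mem_ofPred_eq]
    push_cast
    constructor
    · rintro ⟨hi, h1, h2⟩
      exact ⟨⟨hI0 i hi, by omega⟩, hi⟩
    · rintro ⟨⟨h1, h2⟩, hi⟩
      exact ⟨hi, by omega, by omega⟩
  have hhalf : Tendsto (fun n : ℕ => ((n : ℝ) + 1) / (2 * n + 1)) atTop (𝓝 (1 / 2)) := by
    have h1 : Tendsto (fun n : ℕ => (1 : ℝ) / 2 + 1 / 2 * (1 / (2 * (n : ℝ) + 1))) atTop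
        (𝓝 (1 / 2 + 1 / 2 * 0)) := by
      refine Tendsto.const_add _ (Tendsto.const_mul _ ?_)
      refine Tendsto.div_atTop tendsto_const_nhds ?_
      exact tendsto_atTop_add_const_right _ _
        (tendsto_natCast_atTop_atTop.const_mul_atTop two_pos)
    rw [mul_zero, add_zero] at h1
    refine h1.congr fun n => ?_
    field_simp
    ring
  unfold HasDensity
  simp only [hcount]
  have hup : Tendsto (fun n : ℕ => (maxCard P (n + 1) : ℝ) / ((n + 1 : ℕ) : ℝ) *
      (((n : ℝ) + 1) / (2 * n + 1))) atTop (𝓝 (d * (1 / 2))) :=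
    (hlim.comp (tendsto_add_atTop_nat 1)).mul hhalf
  have hlo : Tendsto (fun n : ℕ => d * (((n : ℝ) + 1) / (2 * n + 1))) atTop (𝓝 (d * (1 / 2))) :=
    hhalf.const_mul d
  rw [show d / 2 = d * (1 / 2) by ring]
  refine tendsto_of_tendsto_of_tendsto_of_le_of_le hlo hup (fun n => ?_) fun n => ?_
  · have := hWd (n + 1)
    push_cast at this
    simp only
    rw [← mul_div_assoc]
    gcongr
  · simp only
    have h1 : (maxCard P (n + 1) : ℝ) / ((n + 1 : ℕ) : ℝ) * (((n : ℝ) + 1) / (2 * n + 1)) =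
        maxCard P (n + 1) / (2 * n + 1) := by
      push_cast
      field_simp
    rw [h1]
    exact div_le_div_of_nonneg_right (hWP (n + 1)) (by positivity)

end Density

/-! ### `ℓ₁`-isomorphism sets and lower `ℓ₁`-estimates. -/

section L1

variable {X : Type*} [NormedAddCommGroup X] [NormedSpace ℂ X]

theorem hasSum_norm_lp_one {ι : Type*} (c : lp (fun _ : ι => ℂ) 1) :
    HasSum (fun i => ‖c i‖) ‖c‖ := by
  simpa using lp.hasSum_norm (p := 1) (by simp) c

/-- A bounded family which satisfies a lower `ℓ₁`-estimate on finite sets is equivalent to the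
standard basis of `ℓ₁`. -/
theorem equivalentToL1Basis_range [CompleteSpace X] {ι : Type*} [DecidableEq ι] (v : ι → X)
    {M : ℝ} (hM : ∀ i, ‖v i‖ ≤ M) {κ : ℝ} (hκ : 0 < κ)
    (h : ∀ (J : Finset ι) (c : ι → ℂ), κ * ∑ i ∈ J, ‖c i‖ ≤ ‖∑ i ∈ J, c i • v i‖) :
    EquivalentToL1Basis (ι := ι) (range v) := by
  have hbound : ∀ (c : lp (fun _ : ι => ℂ) 1) i, ‖c i • v i‖ ≤ M * ‖c i‖ := by
    intro c i
    rw [norm_smul, mul_comm]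
    exact mul_le_mul_of_nonneg_right (hM i) (norm_nonneg _)
  have hsum : ∀ c : lp (fun _ : ι => ℂ) 1, HasSum (fun i => c i • v i) (∑' i, c i • v i) :=
    fun c => (Summable.of_norm_bounded ((hasSum_norm_lp_one c).summable.mul_left M)
      (hbound c)).hasSum
  let Φ : lp (fun _ : ι => ℂ) 1 →L[ℂ] X := LinearMap.mkContinuous
    { toFun := fun c => ∑' i, c i • v i
      map_add' := fun c c' => by
        refine (hsum (c + c')).unique ?_
        simpa [add_smul] using (hsum c).add (hsum c')
      map_smul' := fun a c => by
        refine (hsum (a • c)).unique ?_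
        simpa [mul_smul] using (hsum c).const_smul a } M fun c => by
    exact tsum_of_norm_bounded ((hasSum_norm_lp_one c).mul_left M) (hbound c)
  have hΦ : ∀ c, HasSum (fun i => c i • v i) (Φ c) := hsum
  have hlower : ∀ c, κ * ‖c‖ ≤ ‖Φ c‖ := fun c =>
    le_of_tendsto_of_tendsto' ((hasSum_norm_lp_one c).const_mul κ)
      (hΦ c).norm fun J => h J c
  have hsingle : ∀ i, Φ (lp.single 1 i (1 : ℂ)) = v i := by
    intro i
    refine (hΦ _).unique ?_
    have := hasSum_single (f := fun j => (lp.single 1 i (1 : ℂ) : lp (fun _ : ι => ℂ) 1) j • v j) i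
      fun j hj => by simp [lp.single_apply, Pi.single_eq_of_ne hj]
    simpa using this
  have hanti : AntilipschitzWith (Real.toNNReal κ⁻¹) Φ := by
    refine AddMonoidHomClass.antilipschitz_of_bound Φ fun c => ?_
    rw [Real.coe_toNNReal _ (inv_pos.2 hκ).le, inv_mul_eq_div, le_div_iff₀ hκ, mul_comm]
    exact hlower c
  have hinj : Function.Injective Φ := hanti.injective
  have hclosed : IsClosed (range Φ) := hanti.isClosed_range Φ.uniformContinuous
  set S := (Submodule.span ℂ (range v)).topologicalClosure with hS
  have hmem : ∀ c, Φ c ∈ S := by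
    intro c
    refine mem_closure_of_tendsto (hΦ c) (Eventually.of_forall fun J => ?_)
    exact Submodule.sum_mem _ fun i _ => Submodule.smul_mem _ _
      (Submodule.subset_span (mem_range_self i))
  have hrange : S ≤ LinearMap.range (Φ : lp (fun _ : ι => ℂ) 1 →ₗ[ℂ] X) := by
    refine Submodule.topologicalClosure_minimal _ ?_ hclosed
    rw [Submodule.span_le]
    rintro _ ⟨i, rfl⟩
    exact ⟨_, hsingle i⟩
  have hScl : IsClosed (S : Set X) := Submodule.isClosed_topologicalClosure _
  have : CompleteSpace S := hScl.completeSpace_coe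
  let Ψ : lp (fun _ : ι => ℂ) 1 →L[ℂ] S := Φ.codRestrict S hmem
  have hvinj : Function.Injective v := by
    intro i j hij
    have := hinj ((hsingle i).trans (hij.trans (hsingle j).symm))
    by_contra hne
    have h1 := congrArg (fun c : lp (fun _ : ι => ℂ) 1 => c i) this
    simp [lp.single_apply, Pi.single_eq_of_ne hne] at h1
  refine ⟨Equiv.ofInjective v hvinj, ContinuousLinearEquiv.ofBijective Ψ ?_ ?_, fun i => ?_⟩
  · rw [LinearMap.ker_eq_bot]
    intro c c' hcc
    exact hinj (congrArg Subtype.val hcc)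
  · rw [LinearMap.range_eq_top]
    rintro ⟨y, hy⟩
    obtain ⟨c, hc⟩ := hrange hy
    exact ⟨c, Subtype.ext hc⟩
  · exact hsingle i

theorem isL1IsomorphismSet_of_lower_bound [CompleteSpace X] (α : X ≃ₗᵢ[ℂ] X) (x : X) (I : Set ℤ)
    {κ : ℝ} (hκ : 0 < κ) (h : ∀ J : Finset ℤ, (J : Set ℤ) ⊆ I → ∀ c : ℤ → ℂ,
      κ * ∑ i ∈ J, ‖c i‖ ≤ ‖∑ i ∈ J, c i • (α ^ i) x‖) : IsL1IsomorphismSet α x I := by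
  unfold IsL1IsomorphismSet
  rw [image_eq_range]
  refine equivalentToL1Basis_range _ (M := ‖x‖) (fun i => ((α ^ (i : ℤ)).norm_map x).le) hκ ?_
  intro J c
  classical
  have h1 := h (J.map (Function.Embedding.subtype _)) (by simp)
    (fun i => if hi : i ∈ I then c ⟨i, hi⟩ else 0)
  simpa using h1

theorem HasDensity.infinite {I : Set ℤ} {d : ℝ} (hd : 0 < d) (h : HasDensity I d) :
    I.Infinite := by
  intro hfin
  have h0 : Tendsto (fun n : ℕ => ((I ∩ Set.Icc (-(n : ℤ)) (n : ℤ)).ncard : ℝ) /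
      (2 * (n : ℝ) + 1)) atTop (𝓝 0) := by
    have hup : Tendsto (fun n : ℕ => (I.ncard : ℝ) / (2 * (n : ℝ) + 1)) atTop (𝓝 0) :=
      tendsto_const_nhds.div_atTop (tendsto_atTop_add_const_right _ _
        (tendsto_natCast_atTop_atTop.const_mul_atTop two_pos))
    refine squeeze_zero (fun n => by positivity) (fun n => ?_) hup
    gcongr
    exact Set.inter_subset_left
  exact hd.ne' (tendsto_nhds_unique h h0)

theorem isometryEquiv_mul_apply (α β : X ≃ₗᵢ[ℂ] X) (x : X) : (α * β) x = α (β x) := rfl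

theorem zpow_apply_eq_self (α : X ≃ₗᵢ[ℂ] X) {x : X} (h : α x = x) (m : ℤ) : (α ^ m) x = x := by
  induction m using Int.induction_on with
  | zero => simp
  | succ n ih => rw [zpow_add_one, isometryEquiv_mul_apply, h, ih]
  | pred n ih =>
    have h' : α⁻¹ x = x := by
      conv_lhs => rw [← h]
      exact α.symm_apply_apply x
    rw [zpow_sub_one, isometryEquiv_mul_apply, h', ih]

/-- A repetition would make `x` periodic under `α`, and its whole orbit finite. -/
theorem injective_zpow_apply (α : X ≃ₗᵢ[ℂ] X) {x : X} {I : Set ℤ}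
    (hinf : ((fun i : ℤ => (α ^ i) x) '' I).Infinite) :
    Function.Injective fun i : ℤ => (α ^ i) x := by
  intro i j hij
  by_contra hne
  have hp : i - j ≠ 0 := sub_ne_zero.2 hne
  have hfix : (α ^ (i - j)) x = x := by
    have : i - j = -j + i := by ring
    rw [this, zpow_add, isometryEquiv_mul_apply]
    have hij' : (α ^ i) x = (α ^ j) x := hij
    rw [hij', ← isometryEquiv_mul_apply, ← zpow_add]
    simp
  refine hinf (((Set.finite_Ico (0 : ℤ) |i - j|).image fun k : ℤ => (α ^ k) x).subset ?_)
  rintro _ ⟨k, -, rfl⟩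
  refine ⟨k % (i - j), ⟨Int.emod_nonneg _ hp, Int.emod_lt_abs _ hp⟩, ?_⟩
  calc (α ^ (k % (i - j))) x = (α ^ (k % (i - j) + (i - j) * (k / (i - j)))) x := by
        rw [zpow_add, zpow_mul, isometryEquiv_mul_apply, zpow_apply_eq_self _ hfix]
    _ = (α ^ k) x := by rw [Int.emod_add_mul_ediv]

theorem exists_lower_bound_of_isL1IsomorphismSet {α : X ≃ₗᵢ[ℂ] X} {x : X} {I : Set ℤ}
    (hI : I.Infinite) (h : IsL1IsomorphismSet α x I) :
    ∃ κ : ℝ, 0 < κ ∧ ∀ J : Finset ℤ, (J : Set ℤ) ⊆ I → ∀ c : ℤ → ℂ,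
      κ * ∑ i ∈ J, ‖c i‖ ≤ ‖∑ i ∈ J, c i • (α ^ i) x‖ := by
  classical
  obtain ⟨e, γ, hγ⟩ := h
  have hΔ : ((fun i : ℤ => (α ^ i) x) '' I).Infinite := by
    have := hI.to_subtype
    exact Set.infinite_coe_iff.1 (Infinite.of_injective e e.injective)
  have hinj := injective_zpow_apply α hΔ
  let b : I ≃ ((fun i : ℤ => (α ^ i) x) '' I) := Equiv.Set.image _ I hinj
  -- The bijection `e` need not send `i` to `(α ^ i) x`; the permutation `ψ` corrects this, and
  -- permuting coordinates preserves the `ℓ₁`-norm.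
  let ψ : I ≃ I := b.trans e.symm
  have hψ : ∀ i : I, ((γ (lp.single 1 (ψ i) (1 : ℂ))) : X) = (α ^ (i : ℤ)) x := by
    intro i
    rw [hγ]
    simp [ψ, b]
  obtain ⟨C, hC0, hC⟩ := γ.symm.toContinuousLinearMap.bound
  refine ⟨C⁻¹, by positivity, fun J hJ c => ?_⟩
  let J' : Finset I := J.subtype (· ∈ I)
  let u : lp (fun _ : I => ℂ) 1 := ∑ j ∈ J'.map ψ.toEmbedding, lp.single 1 j (c (ψ.symm j))
  have hu : ‖u‖ = ∑ i ∈ J, ‖c i‖ := by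
    have := lp.norm_sum_single (E := fun _ : I => ℂ) (p := 1) (by simp)
      (fun j => c (ψ.symm j)) (J'.map ψ.toEmbedding)
    simp only [ENNReal.toReal_one, Real.rpow_one] at this
    rw [← Finset.sum_subtype_of_mem (fun i => ‖c i‖) (p := (· ∈ I)) fun i hi => hJ hi]
    simpa [u] using this
  have hγu : ((γ u : _) : X) = ∑ i ∈ J, c i • (α ^ i) x := by
    rw [← Finset.sum_subtype_of_mem (fun i => c i • (α ^ i) x) (p := (· ∈ I)) fun i hi => hJ hi]
    simp only [u, Finset.sum_map, map_sum, Submodule.coe_sum]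
    refine Finset.sum_congr rfl fun i _ => ?_
    have h1 : (lp.single 1 (ψ i) (c i) : lp (fun _ : I => ℂ) 1) =
        c i • lp.single 1 (ψ i) (1 : ℂ) := by
      rw [← lp.single_smul]; simp
    simp only [Equiv.toEmbedding_apply, Equiv.symm_apply_apply]
    rw [h1, map_smul, Submodule.coe_smul, hψ]
  have hle : ‖u‖ ≤ C * ‖γ u‖ := by
    simpa using hC (γ u)
  rw [← hu, ← hγu, inv_mul_le_iff₀ hC0]
  exact hle

end L1

/-! ### Concentration of signed sums. -/

section Signs

/-- The vector of signs which is `1` on `t` and `-1` elsewhere. -/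
noncomputable def signOn {ι : Type*} (t : Finset ι) (i : ι) : ℝ :=
  open Classical in if i ∈ t then 1 else -1

theorem norm_signOn {ι : Type*} (t : Finset ι) (i : ι) : ‖(signOn t i : ℂ)‖ = 1 := by
  unfold signOn; split_ifs <;> simp

open Classical in
/-- Hoeffding's inequality for Rademacher sums, in counting form. -/
theorem card_signs_real_mul_exp_le {ι : Type*} (s : Finset ι) (v : ι → ℝ) {M a : ℝ} (hM : 0 < M)
    (ha : 0 ≤ a) (hv : ∀ i ∈ s, |v i| ≤ M) :
    ((s.powerset.filter fun t => a * s.card ≤ ∑ i ∈ s, signOn t i * v i).card : ℝ) *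
      Real.exp (a ^ 2 / (2 * M ^ 2) * s.card) ≤ 2 ^ s.card := by
  -- The optimal Chernoff parameter: the exponential moment costs `l² M² / 2 = a² / (2 M²)` per
  -- index, half of the gain `l * a`.
  set l := a / M ^ 2 with hl
  have hl0 : 0 ≤ l := by positivity
  have hgen : ∑ t ∈ s.powerset, Real.exp (l * ∑ i ∈ s, signOn t i * v i) ≤
      (2 * Real.exp (a ^ 2 / (2 * M ^ 2))) ^ s.card := by
    have h1 : ∀ t ∈ s.powerset, Real.exp (l * ∑ i ∈ s, signOn t i * v i) =
        (∏ i ∈ t, Real.exp (l * v i)) * ∏ i ∈ s \ t, Real.exp (-(l * v i)) := by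
      intro t ht
      rw [← Real.exp_sum, ← Real.exp_sum, ← Real.exp_add, Finset.mul_sum,
        ← Finset.sum_sdiff (Finset.mem_powerset.1 ht), add_comm]
      congr 2
      · refine Finset.sum_congr rfl fun i hi => ?_
        simp [signOn, hi]
      · refine Finset.sum_congr rfl fun i hi => ?_
        simp [signOn, (Finset.mem_sdiff.1 hi).2]
    rw [Finset.sum_congr rfl h1, ← Finset.prod_add]
    rw [← Finset.prod_const]
    refine Finset.prod_le_prod (fun i _ => by positivity) fun i hi => ?_
    have h2 : Real.exp (l * v i) + Real.exp (-(l * v i)) = 2 * Real.cosh (l * v i) := by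
      rw [Real.cosh_eq]; ring
    rw [h2]
    refine mul_le_mul_of_nonneg_left ((Real.cosh_le_exp_half_sq _).trans ?_) two_pos.le
    rw [Real.exp_le_exp]
    have h3 : (v i) ^ 2 ≤ M ^ 2 := sq_le_sq' (by linarith [neg_abs_le (v i), hv i hi])
      ((le_abs_self _).trans (hv i hi))
    calc (l * v i) ^ 2 / 2 = l ^ 2 / 2 * (v i) ^ 2 := by ring
      _ ≤ l ^ 2 / 2 * M ^ 2 := by gcongr
      _ = a ^ 2 / (2 * M ^ 2) := by rw [hl]; field_simp
  have hlow : ((s.powerset.filter fun t => a * s.card ≤ ∑ i ∈ s, signOn t i * v i).card : ℝ) *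
      Real.exp (l * (a * s.card)) ≤ ∑ t ∈ s.powerset, Real.exp (l * ∑ i ∈ s, signOn t i * v i) := by
    rw [← nsmul_eq_mul, ← Finset.sum_const]
    refine (Finset.sum_le_sum fun t ht => ?_).trans
      (Finset.sum_le_sum_of_subset_of_nonneg (Finset.filter_subset _ _) fun _ _ _ =>
        (Real.exp_pos _).le)
    have := (Finset.mem_filter.1 ht).2
    gcongr
  have h := hlow.trans hgen
  rw [mul_pow, ← Real.exp_nat_mul] at h
  have e1 : l * (a * s.card) =
      a ^ 2 / (2 * M ^ 2) * s.card + s.card * (a ^ 2 / (2 * M ^ 2)) := by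
    rw [hl]; field_simp; ring
  rw [e1, Real.exp_add, ← mul_assoc] at h
  exact le_of_mul_le_mul_right h (Real.exp_pos _)

-- A complex number of norm at least `2 r` has one of `±re`, `±im` at least `r`; the four real
-- estimates account for the factor 4.
open Classical in
theorem card_signs_mul_exp_le {ι : Type*} (s : Finset ι) (v : ι → ℂ) {M a : ℝ} (hM : 0 < M)
    (ha : 0 ≤ a) (hv : ∀ i ∈ s, ‖v i‖ ≤ M) :
    ((s.powerset.filter fun t => 2 * a * s.card ≤ ‖∑ i ∈ s, (signOn t i : ℂ) * v i‖).card : ℝ) *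
      Real.exp (a ^ 2 / (2 * M ^ 2) * s.card) ≤ 4 * 2 ^ s.card := by
  let A : (ι → ℝ) → Finset (Finset ι) := fun w =>
    s.powerset.filter fun t => a * s.card ≤ ∑ i ∈ s, signOn t i * w i
  have hsub : (s.powerset.filter fun t =>
      2 * a * s.card ≤ ‖∑ i ∈ s, (signOn t i : ℂ) * v i‖) ⊆
      (A (fun i => (v i).re) ∪ A (fun i => -(v i).re)) ∪
      (A (fun i => (v i).im) ∪ A (fun i => -(v i).im)) := by
    intro t ht
    obtain ⟨hts, ht⟩ := Finset.mem_filter.1 ht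
    simp only [A, Finset.mem_union, Finset.mem_filter, hts, true_and]
    have h1 := Complex.norm_le_abs_re_add_abs_im (∑ i ∈ s, (signOn t i : ℂ) * v i)
    simp only [Complex.re_sum, Complex.im_sum, Complex.re_ofReal_mul, Complex.im_ofReal_mul] at h1
    simp only [mul_neg, Finset.sum_neg_distrib]
    by_contra! hcon
    obtain ⟨⟨c1, c2⟩, c3, c4⟩ := hcon
    have h2 := abs_lt.2 ⟨by linarith, c1⟩
    have h3 := abs_lt.2 ⟨by linarith, c3⟩
    linarith
  have hA : ∀ w : ι → ℝ, (∀ i ∈ s, |w i| ≤ M) →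
      ((A w).card : ℝ) * Real.exp (a ^ 2 / (2 * M ^ 2) * s.card) ≤ 2 ^ s.card := fun w hw =>
    card_signs_real_mul_exp_le s w hM ha hw
  have hre : ∀ i ∈ s, |(v i).re| ≤ M := fun i hi => (Complex.abs_re_le_norm _).trans (hv i hi)
  have him : ∀ i ∈ s, |(v i).im| ≤ M := fun i hi => (Complex.abs_im_le_norm _).trans (hv i hi)
  have hcard := (Finset.card_le_card hsub).trans ((Finset.card_union_le _ _).trans
    (add_le_add (Finset.card_union_le _ _) (Finset.card_union_le _ _)))
  have hcard' : ((s.powerset.filter fun t =>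
      2 * a * s.card ≤ ‖∑ i ∈ s, (signOn t i : ℂ) * v i‖).card : ℝ) ≤
      ((A fun i => (v i).re).card + (A fun i => -(v i).re).card) +
      ((A fun i => (v i).im).card + (A fun i => -(v i).im).card) := by exact_mod_cast hcard
  have h1 := hA _ hre
  have h2 := hA (fun i => -(v i).re) (by simpa using hre)
  have h3 := hA _ him
  have h4 := hA (fun i => -(v i).im) (by simpa using him)
  have := mul_le_mul_of_nonneg_right hcard' (Real.exp_pos (a ^ 2 / (2 * M ^ 2) * s.card)).le
  linarith

/-- Exponentially many bounded vectors are needed to make all signed sums large. -/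
theorem exp_le_card_of_signs {ι κ : Type*} (s : Finset ι) (Y : Finset κ) (v : κ → ι → ℂ) {M a : ℝ}
    (hM : 0 < M) (ha : 0 ≤ a) (hv : ∀ y ∈ Y, ∀ i ∈ s, ‖v y i‖ ≤ M)
    (hcov : ∀ t ⊆ s, ∃ y ∈ Y, 2 * a * s.card ≤ ‖∑ i ∈ s, (signOn t i : ℂ) * v y i‖) :
    Real.exp (a ^ 2 / (2 * M ^ 2) * s.card) ≤ 4 * Y.card := by
  classical
  have hsub : s.powerset ⊆ Y.biUnion fun y =>
      s.powerset.filter fun t => 2 * a * s.card ≤ ‖∑ i ∈ s, (signOn t i : ℂ) * v y i‖ := by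
    intro t ht
    obtain ⟨y, hy, h⟩ := hcov t (Finset.mem_powerset.1 ht)
    exact Finset.mem_biUnion.2 ⟨y, hy, Finset.mem_filter.2 ⟨ht, h⟩⟩
  have hcard := (Finset.card_le_card hsub).trans Finset.card_biUnion_le
  rw [Finset.card_powerset] at hcard
  have h1 : (2 : ℝ) ^ s.card ≤ ∑ y ∈ Y, ((s.powerset.filter fun t =>
      2 * a * s.card ≤ ‖∑ i ∈ s, (signOn t i : ℂ) * v y i‖).card : ℝ) := by exact_mod_cast hcard
  have h2 : (2 : ℝ) ^ s.card * Real.exp (a ^ 2 / (2 * M ^ 2) * s.card) ≤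
      ∑ y ∈ Y, 4 * (2 : ℝ) ^ s.card := by
    refine (mul_le_mul_of_nonneg_right h1 (Real.exp_pos _).le).trans ?_
    rw [Finset.sum_mul]
    exact Finset.sum_le_sum fun y hy => card_signs_mul_exp_le s (v y) hM ha (hv y hy)
  rw [Finset.sum_const, nsmul_eq_mul] at h2
  have h3 : (0 : ℝ) < 2 ^ s.card := by positivity
  refine le_of_mul_le_mul_left ?_ h3
  linarith

end Signs

/-! ### Positive density `ℓ₁`-sets force exponential complexity. -/

section Dynamics

variable {K : Type*} [TopologicalSpace K] [CompactSpace K]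

theorem inducedAut_pow_apply (T : K ≃ₜ K) (n : ℕ) (f : C(K, ℂ)) (x : K) :
    ((inducedAut T) ^ n) f x = f (T^[n] x) := by
  induction n generalizing f x with
  | zero => rfl
  | succ n ih =>
    rw [pow_succ, isometryEquiv_mul_apply, ih, Function.iterate_succ_apply']
    rfl

theorem norm_sum_zpow_shift {X : Type*} [NormedAddCommGroup X] [NormedSpace ℂ X]
    (α : X ≃ₗᵢ[ℂ] X) (x : X) (J : Finset ℤ) (c : ℤ → ℂ) (k : ℤ) :
    ‖∑ i ∈ J, c i • (α ^ (i + k)) x‖ = ‖∑ i ∈ J, c i • (α ^ i) x‖ := by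
  rw [← (α ^ k).norm_map (∑ i ∈ J, c i • (α ^ i) x), map_sum]
  congr 1
  refine Finset.sum_congr rfl fun i _ => ?_
  rw [map_smul, ← isometryEquiv_mul_apply, ← zpow_add, add_comm]

/-- A function with an `ℓ₁`-isomorphism set of positive density has exponential complexity. -/
theorem not_hasSubexpComplexity {T : K ≃ₜ K} {f : C(K, ℂ)} (h : HasPosDensityL1Set T f) :
    ¬ HasSubexpComplexity T f := by
  classical
  intro hsub
  obtain ⟨I, ⟨d, hd, hdens⟩, hI⟩ := h
  obtain ⟨κ, hκ, hlow⟩ := exists_lower_bound_of_isL1IsomorphismSet (hdens.infinite hd) hI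
  set M := ‖f‖ + 1 with hM
  have hM0 : 0 < M := by positivity
  set a := κ / 4 with ha
  have ha0 : 0 < a := by positivity
  -- With `N = 2 * n + 1` and `|J| ≥ d / 2 * N`, Hoeffding's exponent is at least `2 * c * N`.
  -- Shadowing by at most `exp (c * N)` points then contradicts `4 < exp (c * N)`.
  set c := a ^ 2 * d / (8 * M ^ 2) with hc
  have hc0 : 0 < c := by positivity
  have hodd : Tendsto (fun n : ℕ => 2 * n + 1) atTop atTop :=
    tendsto_atTop_mono (fun n => show n ≤ 2 * n + 1 by omega) tendsto_id
  have h1 := hodd.eventually (hsub (κ / 4) ha0 c hc0)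
  have h2 : ∀ᶠ n : ℕ in atTop, d / 2 <
      ((I ∩ Set.Icc (-(n : ℤ)) (n : ℤ)).ncard : ℝ) / (2 * (n : ℝ) + 1) :=
    hdens.eventually_const_lt (half_lt_self hd)
  have h3 : ∀ᶠ n : ℕ in atTop, Real.log 4 < c * ((2 * n + 1 : ℕ) : ℝ) :=
    ((tendsto_natCast_atTop_atTop.comp hodd).const_mul_atTop hc0).eventually_gt_atTop _
  obtain ⟨n, ⟨E, hE, hshadow⟩, hn2, hn3⟩ := (h1.and (h2.and h3)).exists
  have hfin : (I ∩ Set.Icc (-(n : ℤ)) (n : ℤ)).Finite := (Set.finite_Icc _ _).inter_of_right _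
  set J := hfin.toFinset with hJ
  have hJmem : ∀ i, i ∈ J ↔ i ∈ I ∧ -(n : ℤ) ≤ i ∧ i ≤ n := fun i => by simp [hJ]
  have hJcard : d / 2 * ((2 * n + 1 : ℕ) : ℝ) ≤ J.card := by
    rw [Set.ncard_eq_toFinset_card _ hfin, lt_div_iff₀ (by positivity)] at hn2
    push_cast
    exact hn2.le
  have hJpos : (0 : ℝ) < J.card := lt_of_lt_of_le (by positivity) hJcard
  have hbig := exp_le_card_of_signs J E (fun y i => f (T^[(i + n).toNat] y)) hM0 ha0.le
    (fun y _ i _ => (f.norm_coe_le_norm _).trans (by linarith)) (fun t ht => by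
      -- Shifting times by `n` turns the window `{-n, …, n}` into `{0, …, 2n}`, so only forward
      -- iterates occur.
      have hnorm : κ * J.card ≤
          ‖∑ i ∈ J, (signOn t i : ℂ) • ((inducedAut T) ^ (i + (n : ℤ))) f‖ := by
        rw [norm_sum_zpow_shift]
        have := hlow J (fun i hi => ((hJmem i).1 hi).1) (fun i => (signOn t i : ℂ))
        simpa only [norm_signOn, Finset.sum_const, nsmul_eq_mul, mul_one] using this
      have happly : ∀ x, (∑ i ∈ J, (signOn t i : ℂ) • ((inducedAut T) ^ (i + (n : ℤ))) f) x =
          ∑ i ∈ J, (signOn t i : ℂ) * f (T^[(i + n).toNat] x) := by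
        intro x
        rw [ContinuousMap.coe_sum, Finset.sum_apply]
        refine Finset.sum_congr rfl fun i hi => ?_
        have hi' := (hJmem i).1 hi
        rw [ContinuousMap.smul_apply, smul_eq_mul, ← inducedAut_pow_apply, ← zpow_natCast,
          Int.toNat_of_nonneg (by omega)]
      -- The signed sum is nearly maximal at some `x`; passing to a shadowing point loses at most `κ
      -- / 4` per index, which leaves `κ / 2 = 2 * a`.
      obtain ⟨x, hx⟩ : ∃ x, 3 / 4 * κ * J.card <
          ‖∑ i ∈ J, (signOn t i : ℂ) * f (T^[(i + n).toNat] x)‖ := by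
        by_contra! hcon
        have h5 : ‖∑ i ∈ J, (signOn t i : ℂ) • ((inducedAut T) ^ (i + (n : ℤ))) f‖ ≤
            3 / 4 * κ * J.card :=
          (ContinuousMap.norm_le _ (by positivity)).2 fun x => by rw [happly]; exact hcon x
        have : 0 < κ * J.card := by positivity
        linarith
      obtain ⟨y, hy, hxy⟩ := hshadow x
      refine ⟨y, hy, ?_⟩
      have hdiff : ‖∑ i ∈ J, (signOn t i : ℂ) * f (T^[(i + n).toNat] x) -
          ∑ i ∈ J, (signOn t i : ℂ) * f (T^[(i + n).toNat] y)‖ ≤ J.card * (κ / 4) := by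
        rw [← Finset.sum_sub_distrib]
        refine (norm_sum_le_of_le (n := fun _ => κ / 4) _ fun i hi => ?_).trans (by simp)
        have hi' := (hJmem i).1 hi
        rw [← mul_sub, norm_mul, norm_signOn, one_mul, ← dist_eq_norm]
        exact le_of_lt (hxy _ (by omega))
      have := norm_sub_norm_le (∑ i ∈ J, (signOn t i : ℂ) * f (T^[(i + n).toNat] x))
          (∑ i ∈ J, (signOn t i : ℂ) * f (T^[(i + n).toNat] y))
      rw [ha]
      linarith)
  have h6 : Real.exp (2 * c * ((2 * n + 1 : ℕ) : ℝ)) ≤ Real.exp (a ^ 2 / (2 * M ^ 2) * J.card) := by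
    rw [Real.exp_le_exp]
    calc 2 * c * ((2 * n + 1 : ℕ) : ℝ) = a ^ 2 / (2 * M ^ 2) * (d / 2 * ((2 * n + 1 : ℕ) : ℝ)) := by
          rw [hc]; field_simp; ring
      _ ≤ _ := by gcongr
  have h7 : Real.exp (2 * c * ((2 * n + 1 : ℕ) : ℝ)) ≤ 4 * Real.exp (c * ((2 * n + 1 : ℕ) : ℝ)) := by
    linarith
  rw [show 2 * c * ((2 * n + 1 : ℕ) : ℝ) = c * ((2 * n + 1 : ℕ) : ℝ) + c * ((2 * n + 1 : ℕ) : ℝ) by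
    ring, Real.exp_add] at h7
  have h8 := le_of_mul_le_mul_right h7 (Real.exp_pos _)
  have h9 := (Real.log_lt_iff_lt_exp (by norm_num)).1 hn3
  linarith

end Dynamics

/-! ### Exponential complexity yields positive density `ℓ₁`-sets. -/

section Independence

/-- If all choices between the values `a i` and `b i` are approximately realised by vectors `v` with
`‖∑ i, c i * v i‖ ≤ B`, then `B` dominates the `ℓ₁`-norm of `c`. -/
theorem lower_bound_of_independent {ι : Type*} (s : Finset ι) (c a b : ι → ℂ) {η δ B : ℝ}
    (hη : ∀ i ∈ s, η ≤ ‖a i - b i‖)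
    (h : ∀ σ : ι → Prop, ∃ v : ι → ℂ, ‖∑ i ∈ s, c i * v i‖ ≤ B ∧
      ∀ i ∈ s, (σ i → ‖v i - a i‖ ≤ δ) ∧ (¬ σ i → ‖v i - b i‖ ≤ δ)) :
    (η / 4 - δ) * ∑ i ∈ s, ‖c i‖ ≤ B := by
  have key : ∀ ω : ℂ, ‖ω‖ = 1 →
      ∑ i ∈ s, |(ω * (c i * (a i - b i))).re| - 2 * δ * ∑ i ∈ s, ‖c i‖ ≤ 2 * B := by
    intro ω hω
    -- Comparing this choice with the opposite one makes all the real parts of the differences add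
    -- up without cancellation.
    let σ : ι → Prop := fun i => 0 ≤ (ω * (c i * (a i - b i))).re
    obtain ⟨v, hvB, hv⟩ := h σ
    obtain ⟨w, hwB, hw⟩ := h fun i => ¬ σ i
    have hterm : ∀ i ∈ s, |(ω * (c i * (a i - b i))).re| - 2 * δ * ‖c i‖ ≤
        (ω * (c i * v i)).re - (ω * (c i * w i)).re := by
      intro i hi
      have herr : ∀ z : ℂ, ‖z‖ ≤ δ → |(ω * (c i * z)).re| ≤ δ * ‖c i‖ := by
        intro z hz
        refine (Complex.abs_re_le_norm _).trans ?_
        rw [norm_mul, norm_mul, hω, one_mul, mul_comm]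
        gcongr
      by_cases hσ : σ i
      · have h1 := abs_le.1 (herr _ ((hv i hi).1 hσ))
        have h2 := abs_le.1 (herr _ ((hw i hi).2 (not_not.2 hσ)))
        rw [abs_of_nonneg hσ]
        simp only [mul_sub, Complex.sub_re] at h1 h2 ⊢
        linarith
      · have h1 := abs_le.1 (herr _ ((hv i hi).2 hσ))
        have h2 := abs_le.1 (herr _ ((hw i hi).1 hσ))
        rw [abs_of_neg (not_le.1 hσ)]
        simp only [mul_sub, Complex.sub_re] at h1 h2 ⊢
        linarith
    have hbd : ∀ u : ι → ℂ, ‖∑ i ∈ s, c i * u i‖ ≤ B → |∑ i ∈ s, (ω * (c i * u i)).re| ≤ B := by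
      intro u hu
      rw [← Complex.re_sum, ← Finset.mul_sum]
      refine (Complex.abs_re_le_norm _).trans ?_
      rwa [norm_mul, hω, one_mul]
    have hsum := Finset.sum_le_sum hterm
    rw [Finset.sum_sub_distrib, Finset.sum_sub_distrib, ← Finset.mul_sum] at hsum
    have h1 := abs_le.1 (hbd v hvB)
    have h2 := abs_le.1 (hbd w hwB)
    linarith
  -- The rotations `1` and `I` control real and imaginary parts; together they give `η ∑ ‖c i‖ ≤ 4 B
  -- + 4 δ ∑ ‖c i‖`, hence the constant `η / 4 - δ`.
  have h1 := key 1 (by simp)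
  have h2 := key Complex.I (by simp)
  have h3 : η * ∑ i ∈ s, ‖c i‖ ≤ ∑ i ∈ s, |(1 * (c i * (a i - b i))).re| +
      ∑ i ∈ s, |(Complex.I * (c i * (a i - b i))).re| := by
    rw [Finset.mul_sum, ← Finset.sum_add_distrib]
    refine Finset.sum_le_sum fun i hi => ?_
    have := Complex.norm_le_abs_re_add_abs_im (c i * (a i - b i))
    rw [one_mul, Complex.I_mul_re, abs_neg]
    refine le_trans ?_ this
    rw [norm_mul, mul_comm]
    exact mul_le_mul_of_nonneg_left (hη i hi) (norm_nonneg _)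
  linarith

/-- Greedy extension: if no separated set had more than `b` elements, every separated set could be
enlarged, giving separated sets of all sizes. -/
theorem exists_separated {K : Type*} (T : K → K) (f : K → ℂ) {ε : ℝ} (hε : 0 < ε) (n : ℕ) (b : ℝ)
    (h : ∀ E : Finset K, (E.card : ℝ) ≤ b → ∃ x, ∀ y ∈ E, ∃ k < n,
      ε ≤ dist (f (T^[k] x)) (f (T^[k] y))) :
    ∃ E : Finset K, b < E.card ∧ ∀ x ∈ E, ∀ y ∈ E, x ≠ y → ∃ k < n,
      ε ≤ dist (f (T^[k] x)) (f (T^[k] y)) := by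
  classical
  by_contra! hcon
  have hall : ∀ m : ℕ, ∃ E : Finset K, E.card = m ∧ ∀ x ∈ E, ∀ y ∈ E, x ≠ y → ∃ k < n,
      ε ≤ dist (f (T^[k] x)) (f (T^[k] y)) := by
    intro m
    induction m with
    | zero => exact ⟨∅, by simp⟩
    | succ m ih =>
      obtain ⟨E, hm, hE⟩ := ih
      have hle : (E.card : ℝ) ≤ b := by
        by_contra hlt
        obtain ⟨x, hx, y, hy, hne, hk⟩ := hcon E (not_le.1 hlt)
        obtain ⟨k, hkn, hk'⟩ := hE x hx y hy hne
        exact absurd hk' (not_le.2 (hk k hkn))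
      obtain ⟨x, hx⟩ := h E hle
      have hxE : x ∉ E := fun hmem => by
        obtain ⟨k, -, hk⟩ := hx x hmem
        rw [dist_self] at hk
        linarith
      refine ⟨insert x E, by rw [Finset.card_insert_of_notMem hxE, hm], ?_⟩
      intro y hy z hz hne
      rcases Finset.mem_insert.1 hy with rfl | hyE
      · rcases Finset.mem_insert.1 hz with rfl | hzE
        · exact absurd rfl hne
        · exact hx z hzE
      · rcases Finset.mem_insert.1 hz with rfl | hzE
        · obtain ⟨k, hk, hle⟩ := hx y hyE
          exact ⟨k, hk, by rwa [dist_comm]⟩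
        · exact hE y hyE z hzE hne
  obtain ⟨E, hm, hE⟩ := hall (⌊b⌋₊ + 1)
  obtain ⟨x, hx, y, hy, hne, hk⟩ := hcon E (by rw [hm]; push_cast; exact Nat.lt_floor_add_one b)
  obtain ⟨k, hkn, hk'⟩ := hE x hx y hy hne
  exact absurd hk' (not_le.2 (hk k hkn))

variable {K : Type*} [TopologicalSpace K] [CompactSpace K]

theorem exists_finite_coloring (f : C(K, ℂ)) {δ : ℝ} (hδ : 0 < δ) :
    ∃ (A : Finset ℂ) (col : K → A), ∀ x, dist (f x) (col x : ℂ) ≤ δ := by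
  classical
  obtain ⟨t, -, ht, hcov⟩ := (isCompact_range f.continuous).finite_cover_balls hδ
  have : ∀ x, ∃ a : ht.toFinset, dist (f x) (a : ℂ) ≤ δ := by
    intro x
    obtain ⟨a, ha, hxa⟩ := mem_iUnion₂.1 (hcov (mem_range_self x))
    exact ⟨⟨a, ht.mem_toFinset.2 ha⟩, (Metric.mem_ball.1 hxa).le⟩
  choose col hcol using this
  exact ⟨ht.toFinset, col, hcol⟩

/-- A continuous function of exponential complexity satisfies uniform lower `ℓ₁`-estimates along
sets of times of positive proportion in arbitrarily long intervals. -/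
theorem exists_frequently_lower_bound {T : K ≃ₜ K} {f : C(K, ℂ)} (h : ¬ HasSubexpComplexity T f) :
    ∃ κ : ℝ, 0 < κ ∧ ∃ ρ : ℝ, 0 < ρ ∧ ∃ᶠ n : ℕ in atTop, ∃ J : Finset ℤ,
      (∀ c : ℤ → ℂ, κ * ∑ i ∈ J, ‖c i‖ ≤ ‖∑ i ∈ J, c i • ((inducedAut T) ^ i) f‖) ∧
      J ⊆ Finset.Ico (0 : ℤ) n ∧ ρ * n ≤ J.card := by
  classical
  unfold HasSubexpComplexity SubexpCover at h
  push Not at h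
  obtain ⟨ε, hε, c, hc, hfreq⟩ := h
  -- Any `δ` small enough that `(ε - 2 * δ) / 8 > δ` would do. Rounding values to the alphabet costs
  -- `2 * δ` in separation, and halving the threshold gives `htri`.
  set δ := ε / 100 with hδ
  have hδ0 : 0 < δ := by positivity
  obtain ⟨A, col, hcol⟩ := exists_finite_coloring f hδ0
  let far' : A → A → Prop := fun a b => ε - 2 * δ ≤ dist (a : ℂ) b
  let far : A → A → Prop := fun a b => (ε - 2 * δ) / 2 ≤ dist (a : ℂ) b
  have hirr : ∀ a, ¬ far a a := fun a ha => by
    simp only [far, dist_self] at ha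
    linarith
  have hsymm : ∀ a b, far a b → far b a := fun a b hab => by
    simpa only [far, dist_comm] using hab
  have htri : ∀ a b z, far' a b → far z a ∨ far z b := by
    intro a b z hab
    by_contra! hcon
    simp only [far, far', not_le] at hcon hab
    have := dist_triangle_left (a : ℂ) b z
    linarith [hcon.1, hcon.2]
  obtain ⟨ρ, hρ, hev⟩ := exists_shattered hirr hsymm htri hc
  refine ⟨(ε - 2 * δ) / 2 / 4 - δ, by rw [hδ]; linarith, ρ, hρ, ?_⟩
  refine (hfreq.and_eventually hev).mono ?_
  rintro n ⟨hn, hshat⟩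
  obtain ⟨E, hEcard, hE⟩ := exists_separated T f hε n (Real.exp (c * n)) fun E hE => by
    obtain ⟨x, hx⟩ := hn E hE
    refine ⟨x, fun y hy => ?_⟩
    obtain ⟨k, hk, hmem⟩ := hx y hy
    exact ⟨k, hk, not_lt.1 hmem⟩
  let word : K → Fin n → A := fun x i => col (T^[i] x)
  have hword : ∀ x ∈ E, ∀ y ∈ E, x ≠ y → ∃ i, far' (word x i) (word y i) := by
    intro x hx y hy hne
    obtain ⟨k, hk, hle⟩ := hE x hx y hy hne
    refine ⟨⟨k, hk⟩, ?_⟩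
    have h1 := hcol (T^[k] x)
    have h2 := hcol (T^[k] y)
    have h3 := dist_triangle4_right (f (T^[k] x)) (f (T^[k] y)) (col (T^[k] x) : ℂ)
      (col (T^[k] y) : ℂ)
    simp only [far', word]
    linarith
  have hinj : Set.InjOn word E := by
    intro x hx y hy hxy
    by_contra hne
    obtain ⟨i, hi⟩ := hword x hx y hy hne
    rw [hxy] at hi
    simp only [far', dist_self] at hi
    linarith
  obtain ⟨p, hp, hpcard⟩ := hshat (E.image word)
    (by rw [Finset.card_image_of_injOn hinj]; exact hEcard.le) (by
      intro w hw w' hw' hne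
      obtain ⟨x, hx, rfl⟩ := Finset.mem_image.1 hw
      obtain ⟨y, hy, rfl⟩ := Finset.mem_image.1 hw'
      exact hword x hx y hy fun hxy => hne (by rw [hxy]))
  set s := Finset.univ.filter fun i => (p i).isSome with hs
  have hcast : Function.Injective fun i : Fin n => ((i : ℕ) : ℤ) := fun i j hij =>
    Fin.ext (Nat.cast_injective hij)
  refine ⟨s.image fun i : Fin n => ((i : ℕ) : ℤ), fun c => ?_, ?_, ?_⟩
  · rw [Finset.sum_image hcast.injOn, Finset.sum_image hcast.injOn]
    have hpart : ∀ i ∈ s, ∃ q, p i = some q := fun i hi =>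
      Option.isSome_iff_exists.1 (Finset.mem_filter.1 hi).2
    obtain ⟨x₀, -⟩ : E.Nonempty := by
      rw [← Finset.card_pos]
      exact_mod_cast (Real.exp_pos _).trans hEcard
    have : Nonempty A := ⟨col x₀⟩
    choose! q hq using hpart
    refine lower_bound_of_independent s (fun i => c i) (fun i => ((q i).1 : ℂ))
      (fun i => ((q i).2 : ℂ)) (fun i hi => ?_) fun σ => ?_
    · rw [← dist_eq_norm]
      exact hp.1 i (q i) (hq i hi)
    · obtain ⟨w, hw, hσ⟩ := hp.2 σ
      obtain ⟨x, -, rfl⟩ := Finset.mem_image.1 hw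
      refine ⟨fun i => f (T^[i] x), ?_, fun i hi => ⟨fun h => ?_, fun h => ?_⟩⟩
      · have := (∑ i ∈ s, c i • ((inducedAut T) ^ ((i : ℕ) : ℤ)) f).norm_coe_le_norm x
        rw [ContinuousMap.coe_sum, Finset.sum_apply] at this
        simpa only [ContinuousMap.smul_apply, smul_eq_mul, zpow_natCast,
          inducedAut_pow_apply] using this
      · have h1 := (hσ i (q i) (hq i hi)).1 h
        rw [← dist_eq_norm, ← h1]
        exact hcol _
      · have h1 := (hσ i (q i) (hq i hi)).2 h
        rw [← dist_eq_norm, ← h1]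
        exact hcol _
  · intro j hj
    obtain ⟨i, -, rfl⟩ := Finset.mem_image.1 hj
    rw [Finset.mem_Ico]
    have := i.2
    constructor <;> omega
  · rwa [Finset.card_image_of_injective _ hcast]

theorem hasPosDensityL1Set_of_not_hasSubexpComplexity {T : K ≃ₜ K} {f : C(K, ℂ)}
    (h : ¬ HasSubexpComplexity T f) : HasPosDensityL1Set T f := by
  classical
  obtain ⟨κ, hκ, ρ, hρ, hfreq⟩ := exists_frequently_lower_bound h
  -- The property is the estimate with a fixed `κ`: extending coefficients by zero makes it
  -- hereditary, and isometry of `α` makes it translation invariant.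
  obtain ⟨I, hdens, hI⟩ := exists_hasDensity (P := fun J : Finset ℤ =>
    ∀ c : ℤ → ℂ, κ * ∑ i ∈ J, ‖c i‖ ≤ ‖∑ i ∈ J, c i • ((inducedAut T) ^ i) f‖)
    (fun J J' hJJ hJ' c => by
      have := hJ' fun i => if i ∈ J then c i else 0
      simpa [ite_smul, apply_ite, Finset.sum_ite_mem, Finset.inter_eq_right.2 hJJ] using this)
    (fun J k hJ c => by
      rw [Finset.sum_image (add_left_injective k).injOn,
        Finset.sum_image (add_left_injective k).injOn, norm_sum_zpow_shift]
      exact hJ fun i => c (i + k)) hρ hfreq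
  exact ⟨I, hdens, isL1IsomorphismSet_of_lower_bound _ f I hκ hI⟩

theorem hasPosDensityL1Set_iff {T : K ≃ₜ K} {f : C(K, ℂ)} :
    HasPosDensityL1Set T f ↔ ¬ HasSubexpComplexity T f :=
  ⟨not_hasSubexpComplexity, hasPosDensityL1Set_of_not_hasSubexpComplexity⟩

end Independence

/-! ### Factors, their algebras and complexity. -/

theorem HasSubexpComplexity.of_semiconj {K L : Type*} {T : K → K} {S : L → L} {π : K → L}
    (hπ : Function.Surjective π) (heq : Function.Semiconj π T S) {g : L → ℂ}
    (h : HasSubexpComplexity T (g ∘ π)) : HasSubexpComplexity S g := by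
  classical
  intro ε hε c hc
  filter_upwards [h ε hε c hc] with n hn
  obtain ⟨E, hE, hx⟩ := hn
  refine ⟨E.image π, le_trans (by exact_mod_cast Finset.card_image_le) hE, fun z => ?_⟩
  obtain ⟨x, rfl⟩ := hπ z
  obtain ⟨y, hy, hk⟩ := hx x
  refine ⟨π y, Finset.mem_image_of_mem _ hy, fun k hkn => ?_⟩
  rw [← (heq.iterate_right k).eq, ← (heq.iterate_right k).eq]
  exact hk k hkn

theorem HasSubexpComplexity.comp_semiconj {K L : Type*} {T : K → K} {S : L → L} {π : K → L}
    (hπ : Function.Surjective π) (heq : Function.Semiconj π T S) {g : L → ℂ}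
    (h : HasSubexpComplexity S g) : HasSubexpComplexity T (g ∘ π) := by
  classical
  intro ε hε c hc
  filter_upwards [h ε hε c hc] with n hn
  obtain ⟨E, hE, hx⟩ := hn
  refine ⟨E.image (Function.surjInv hπ), le_trans (by exact_mod_cast Finset.card_image_le) hE,
    fun x => ?_⟩
  obtain ⟨y, hy, hk⟩ := hx (π x)
  refine ⟨Function.surjInv hπ y, Finset.mem_image_of_mem _ hy, fun k hkn => ?_⟩
  have := hk k hkn
  simp only [valueRel, Set.mem_ofPred_eq, Function.comp_apply] at this ⊢
  rwa [(heq.iterate_right k).eq, (heq.iterate_right k).eq, Function.surjInv_eq hπ]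

variable {K : Type u} [TopologicalSpace K] {T : K ≃ₜ K}

theorem Factor.mem_algebra_iff (F : Factor T) (f : C(K, ℂ)) :
    f ∈ F.algebra ↔ ∃ g : C(F.space, ℂ), g.comp F.proj = f :=
  Iff.rfl

theorem Factor.hasZeroEntropy_iff (F : Factor T) :
    F.HasZeroEntropy ↔ ∀ f ∈ F.algebra, HasSubexpComplexity T f := by
  have heq : Function.Semiconj F.proj T F.homeo := F.equivariant
  rw [Factor.HasZeroEntropy, Factor.entropy, topEntropy_le_zero_iff]
  constructor
  · intro h f hf
    obtain ⟨g, rfl⟩ := (F.mem_algebra_iff f).1 hf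
    exact (h g).comp_semiconj F.surjective heq
  · intro h g
    exact (h _ ((F.mem_algebra_iff _).2 ⟨g, rfl⟩)).of_semiconj F.surjective heq

theorem Factor.IsBelow.algebra_le {F G : Factor T} (h : F.IsBelow G) {f : C(K, ℂ)}
    (hf : f ∈ F.algebra) : f ∈ G.algebra := by
  obtain ⟨ρ, -, hρ⟩ := h
  obtain ⟨g, rfl⟩ := (F.mem_algebra_iff f).1 hf
  refine (G.mem_algebra_iff _).2 ⟨g.comp ρ, ?_⟩
  ext x
  simp [hρ]

/-- The functions in the algebra determine the fibres of the factor map, and a continuous surjection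
from a compact space to a Hausdorff space is a quotient map, so the map of fibres descends
continuously. -/
theorem Factor.isBelow_of_algebra_le [CompactSpace K] {F G : Factor T} (h : ∀ f ∈ F.algebra, f ∈ G.algebra) :
    F.IsBelow G := by
  have hfib : ∀ x y, G.proj x = G.proj y → F.proj x = F.proj y := by
    intro x y hxy
    refine eq_of_forall_apply_eq fun g => ?_
    obtain ⟨g', hg'⟩ := (G.mem_algebra_iff _).1 (h _ ((F.mem_algebra_iff _).2 ⟨g, rfl⟩))
    have h1 := DFunLike.congr_fun hg' x
    have h2 := DFunLike.congr_fun hg' y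
    simp only [ContinuousMap.comp_apply] at h1 h2
    rw [← h1, ← h2, hxy]
  have hquot : Topology.IsQuotientMap G.proj :=
    IsQuotientMap.of_surjective_continuous G.surjective G.proj.continuous
  let ρ : C(G.space, F.space) := hquot.lift F.proj fun x y hxy => hfib x y hxy
  have hρ : ∀ x, ρ (G.proj x) = F.proj x := fun x =>
    DFunLike.congr_fun (hquot.lift_comp F.proj fun x y hxy => hfib x y hxy) x
  refine ⟨ρ, fun y => ?_, hρ⟩
  obtain ⟨x, rfl⟩ := G.surjective y
  rw [← G.equivariant, hρ, hρ, F.equivariant]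

theorem hasSubexpComplexity_comp_homeo {f : C(K, ℂ)} :
    HasSubexpComplexity T (f.comp (T : C(K, K))) ↔ HasSubexpComplexity T f :=
  ⟨fun h => HasSubexpComplexity.of_semiconj T.surjective (fun _ => rfl) h,
    fun h => HasSubexpComplexity.comp_semiconj T.surjective (fun _ => rfl) h⟩

theorem hasSubexpComplexity_comp_homeo_symm {f : C(K, ℂ)} :
    HasSubexpComplexity T (f.comp (T.symm : C(K, K))) ↔ HasSubexpComplexity T f := by
  rw [← hasSubexpComplexity_comp_homeo]
  have : (f.comp (T.symm : C(K, K))).comp (T : C(K, K)) = f := by ext x; simp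
  rw [this]

/-! ### The Pinsker factor and completely positive entropy. -/

variable (T)

/-- The functions of subexponential complexity. -/
abbrev SubexpFun : Type u := {f : C(K, ℂ) // HasSubexpComplexity T f}

/-- Joint evaluation of the functions of subexponential complexity. -/
noncomputable def jointEval : C(K, SubexpFun T → ℂ) := ⟨fun x f => f.1 x, by fun_prop⟩

noncomputable def SubexpFun.comp (f : SubexpFun T) : SubexpFun T :=
  ⟨f.1.comp (T : C(K, K)), hasSubexpComplexity_comp_homeo.2 f.2⟩

noncomputable def SubexpFun.compSymm (f : SubexpFun T) : SubexpFun T :=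
  ⟨f.1.comp (T.symm : C(K, K)), hasSubexpComplexity_comp_homeo_symm.2 f.2⟩

/-- The homeomorphism induced by `T` on the image of `K` under joint evaluation. -/
noncomputable def jointEvalHomeo : range (jointEval T) ≃ₜ range (jointEval T) where
  toFun z := ⟨fun f => z.1 (SubexpFun.comp T f), by
    obtain ⟨_, x, rfl⟩ := z
    exact ⟨T x, rfl⟩⟩
  invFun z := ⟨fun f => z.1 (SubexpFun.compSymm T f), by
    obtain ⟨_, x, rfl⟩ := z
    exact ⟨T.symm x, rfl⟩⟩
  left_inv z := by
    obtain ⟨_, x, rfl⟩ := z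
    ext f
    simp [jointEval, SubexpFun.comp, SubexpFun.compSymm]
  right_inv z := by
    obtain ⟨_, x, rfl⟩ := z
    ext f
    simp [jointEval, SubexpFun.comp, SubexpFun.compSymm]
  continuous_toFun := by
    refine Continuous.subtype_mk (continuous_pi fun f => ?_) _
    exact (continuous_apply _).comp continuous_subtype_val
  continuous_invFun := by
    refine Continuous.subtype_mk (continuous_pi fun f => ?_) _
    exact (continuous_apply _).comp continuous_subtype_val

variable [CompactSpace K]

/-- The factor of `(K, T)` generated by the functions of subexponential complexity. -/
noncomputable def subexpFactor : Factor T where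
  space := range (jointEval T)
  compactSpace := isCompact_iff_compactSpace.1 (isCompact_range (jointEval T).continuous)
  homeo := jointEvalHomeo T
  proj := ⟨rangeFactorization (jointEval T), (jointEval T).continuous.rangeFactorization⟩
  surjective := rangeFactorization_surjective
  equivariant _ := rfl

/-- A function of subexponential complexity is a coordinate of the joint evaluation. Conversely, a
function on the factor separates no more points than these coordinates, so
`hasSubexpComplexity_of_separation` applies. -/
theorem mem_algebra_subexpFactor (f : C(K, ℂ)) :
    f ∈ (subexpFactor T).algebra ↔ HasSubexpComplexity T f := by
  rw [Factor.mem_algebra_iff]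
  constructor
  · rintro ⟨g, rfl⟩
    refine hasSubexpComplexity_of_separation _ fun x y hxy => ?_
    have : (subexpFactor T).proj x = (subexpFactor T).proj y :=
      Subtype.ext (funext fun f => hxy f.1 f.2)
    simp only [ContinuousMap.comp_apply, this]
  · intro hf
    exact ⟨⟨fun z : range (jointEval T) => z.1 ⟨f, hf⟩,
      (continuous_apply _).comp continuous_subtype_val⟩, rfl⟩

theorem isPinsker_subexpFactor : (subexpFactor T).IsPinsker := by
  refine ⟨(Factor.hasZeroEntropy_iff _).2 fun f hf => (mem_algebra_subexpFactor T f).1 hf,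
    fun G hG => Factor.isBelow_of_algebra_le fun f hf => ?_⟩
  exact (mem_algebra_subexpFactor T f).2 ((Factor.hasZeroEntropy_iff G).1 hG f hf)

variable {T}

theorem Factor.IsPinsker.mem_algebra_iff {F : Factor T} (hF : F.IsPinsker) (f : C(K, ℂ)) :
    f ∈ F.algebra ↔ HasSubexpComplexity T f :=
  ⟨fun hf => F.hasZeroEntropy_iff.1 hF.1 f hf, fun hf =>
    (hF.2 _ (isPinsker_subexpFactor T).1).algebra_le ((mem_algebra_subexpFactor T f).2 hf)⟩

/-- A nonconstant function of subexponential complexity makes `subexpFactor T` a nontrivial factor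
of zero entropy. Conversely, a function separating two points of such a factor lifts to a
nonconstant one of subexponential complexity. -/
theorem hasCompletelyPositiveEntropy_iff :
    HasCompletelyPositiveEntropy T ↔
      ∀ f : C(K, ℂ), (¬ ∃ c : ℂ, ∀ x, f x = c) → ¬ HasSubexpComplexity T f := by
  constructor
  · intro h f hf hsub
    obtain ⟨g, hg⟩ := (Factor.mem_algebra_iff _ f).1 ((mem_algebra_subexpFactor T f).2 hsub)
    have hnt : Nontrivial (subexpFactor T).space := by
      by_contra hcon
      rw [not_nontrivial_iff_subsingleton] at hcon
      refine hf ?_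
      rcases isEmpty_or_nonempty K with hK | ⟨⟨x₀⟩⟩
      · exact ⟨0, fun x => hK.elim x⟩
      · refine ⟨f x₀, fun x => ?_⟩
        rw [← hg, ContinuousMap.comp_apply, ContinuousMap.comp_apply,
          Subsingleton.elim ((subexpFactor T).proj x) ((subexpFactor T).proj x₀)]
    exact absurd (isPinsker_subexpFactor T).1 (not_le.2 (h _ hnt))
  · intro h F hnt
    by_contra hcon
    have hzero : F.HasZeroEntropy := not_lt.1 hcon
    obtain ⟨y, z, hyz⟩ := hnt
    refine hyz (eq_of_forall_apply_eq fun g => ?_)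
    by_contra hne
    refine h (g.comp F.proj) ?_
      (F.hasZeroEntropy_iff.1 hzero _ ((F.mem_algebra_iff _).2 ⟨g, rfl⟩))
    rintro ⟨c, hc⟩
    obtain ⟨y', rfl⟩ := F.surjective y
    obtain ⟨z', rfl⟩ := F.surjective z
    exact hne ((hc y').trans (hc z').symm)

end PinskerL1

theorem theorem5 {K : Type u} [TopologicalSpace K] [CompactSpace K] [T2Space K] (T : K ≃ₜ K) :
    (∃ F : PinskerL1.Factor T, F.IsPinsker) ∧
    (∀ F : PinskerL1.Factor T, F.IsPinsker →
      (F.algebra : Set C(K, ℂ)) = {f | ¬ PinskerL1.HasPosDensityL1Set T f}) ∧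
    (0 < PinskerL1.topEntropy T ↔ ∃ f : C(K, ℂ), PinskerL1.HasPosDensityL1Set T f) ∧
    (PinskerL1.HasCompletelyPositiveEntropy T ↔
      ∀ f : C(K, ℂ), (¬ ∃ c : ℂ, ∀ x, f x = c) → PinskerL1.HasPosDensityL1Set T f) := by
  refine ⟨⟨_, PinskerL1.isPinsker_subexpFactor T⟩, fun F hF => ?_, ?_, ?_⟩
  · ext f
    rw [SetLike.mem_coe, hF.mem_algebra_iff, Set.mem_ofPred_eq, PinskerL1.hasPosDensityL1Set_iff,
      not_not]
  · rw [← not_le, PinskerL1.topEntropy_le_zero_iff, not_forall]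
    simp only [PinskerL1.hasPosDensityL1Set_iff]
  · rw [PinskerL1.hasCompletelyPositiveEntropy_iff]
    simp only [PinskerL1.hasPosDensityL1Set_iff]
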